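/- Let $A\in\mathbf R^{n\times n}$, $B\in\mathbf R^{n\times 1}$ with $(A,B)$ stabilizable, i.e. $A+BF$ has spectral radius less than $1$ for some $F\in\mathbf R^{1\times n}$. Let $\mathcal G$ be an undirected connected (simple, unweighted) graph on $N\ge 2$ vertices, with adjacency matrix $[a_{ij}]$, $a_{ij}\in\{0,1\}$, and with Laplacian eigenvalues $0=\lambda_1<\lambda_2\le\dots\le\lambda_N$. Consider the $N$ agents $$x_i(k+1)=Ax_i(k)+Bu_i(k),\qquad u_i(k)=\alpha\sum_{j=1}^N a_{ij}\,[1+\tilde\Delta_i(k)]\,K\,[x_i(k)-x_j(k)],\qquad i=1,\dots,N,$$ with $\alpha>0$ and $K\in\mathbf R^{1\times n}$, where the real random variables $\tilde\Delta_i(k)$, $i=1,\dots,N$, $k\ge 0$, are independent with $\mathbf E\tilde\Delta_i(k)=0$ and $\mathbf E\tilde\Delta_i(k)^2=\tilde\sigma_i^2$. Put $\varrho^2=\max_i\tilde\sigma_i^2$ and $M(A)=\prod_{i=1}^n\max\{1,|\lambda_i(A)|\}$, the product over the complex eigenvalues of $A$ with multiplicity. Say that the protocol with gain $K$ solves the mean-square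 consensus problem if $\lim_{k\to\infty}\mathbf E\|x_i(k)-x_j(k)\|^2=0$ for all $i,j$ and for all square-integrable initial states that are independent of the noises (in particular for all deterministic ones). Suppose that $$(\alpha\lambda_i-1)^2+\alpha^2\varrho^2\lambda_i^2<\frac1{M(A)^2},\qquad i=2,N.$$ Then there is a gain $K$ for which the protocol solves the mean-square consensus problem. Moreover, for every $\delta\in\mathbf R$ with $$\max_{i=2,N}\{(\alpha\lambda_i-1)^2+\alpha^2\varrho^2\lambda_i^2\}\le\delta^2<\frac1{M(A)^2}$$ and every symmetric positive definite $Q\in\mathbf R^{n\times n}$, the modified algebraic Riccati equation $$P=A^TPA-(1-\delta^2)A^TPB(B^TPB)^{-1}B^TPA+Q$$ has a unique positive definite solution $P$, and the gain $K=-(B^TPB)^{-1}B^TPA$ solves the mean-square consensus problem. (If $B=0$, so that $B^TPB=0$, the inverse $(B^TPB)^{-1}$ is read as $0$.) -/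

import Mathlib

open MeasureTheory ProbabilityTheory Filter Topology Matrix

noncomputable section

/-- The pair `(A, B)` of a discrete-time linear system with scalar input is stabilizable: some state
feedback places all (complex) eigenvalues of `A + B K` in the open unit disc. -/
def Stabilizable {n : ℕ} (A : Matrix (Fin n) (Fin n) ℝ) (B : Matrix (Fin n) (Fin 1) ℝ) : Prop :=
  ∃ K : Matrix (Fin 1) (Fin n) ℝ,
    ∀ z ∈ spectrum ℂ ((A + B * K).map (fun r : ℝ => (r : ℂ))), ‖z‖ < 1

/-- The Mahler measure `M(A) = ∏ max {1, |λ_i(A)|}`, the product running over the complex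
eigenvalues of `A`, counted with algebraic multiplicity. -/
def matrixMahler {n : ℕ} (A : Matrix (Fin n) (Fin n) ℝ) : ℝ :=
  (((A.map (fun r : ℝ => (r : ℂ))).charpoly.roots).map (fun z => max 1 ‖z‖)).prod

/-- `P` is a positive definite solution of the modified algebraic Riccati equation
`P = Aᵀ P A - (1 - δ²) Aᵀ P B (Bᵀ P B)⁻¹ Bᵀ P A + Q`. -/
def IsMARESolution {n : ℕ} (A : Matrix (Fin n) (Fin n) ℝ) (B : Matrix (Fin n) (Fin 1) ℝ)
    (δ : ℝ) (Q P : Matrix (Fin n) (Fin n) ℝ) : Prop :=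
  P.PosDef ∧
    P = Aᵀ * P * A - (1 - δ ^ 2) • (Aᵀ * P * B * (Bᵀ * P * B)⁻¹ * Bᵀ * P * A) + Q

/-- The feedback gain `K = -(Bᵀ P B)⁻¹ Bᵀ P A`. -/
def riccatiGain {n : ℕ} (A : Matrix (Fin n) (Fin n) ℝ) (B : Matrix (Fin n) (Fin 1) ℝ)
    (P : Matrix (Fin n) (Fin n) ℝ) : Matrix (Fin 1) (Fin n) ℝ :=
  -((Bᵀ * P * B)⁻¹ * Bᵀ * P * A)

/-- The Laplacian eigenvalues of a graph on `N` vertices in nondecreasing order, with multiplicity.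
The index starts at `0`, so `lapEigenvalue G i` is the `(i + 1)`-st smallest eigenvalue. -/
def lapEigenvalue {N : ℕ} (G : SimpleGraph (Fin N)) [DecidableRel G.Adj] (i : Fin N) : ℝ :=
  (G.isHermitian_lapMatrix ℝ).eigenvalues₀ (Fin.cast (Fintype.card_fin N).symm i.rev)

/-- The control input `u_i = α ∑_j a_ij (1 + w_i) K (x_i - x_j)` of agent `i`, when the agents are in
the states `x` and the current values of the input channel uncertainties are `w`. -/
def controlInput {n N : ℕ} (G : SimpleGraph (Fin N)) [DecidableRel G.Adj] (α : ℝ)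
    (K : Matrix (Fin 1) (Fin n) ℝ) (w : Fin N → ℝ) (x : Fin N → Fin n → ℝ) (i : Fin N) :
    Fin 1 → ℝ :=
  α • ∑ j, (G.adjMatrix ℝ i j * (1 + w i)) • (K *ᵥ (x i - x j))

/-- The states of the agents at time `k`, generated by `x_i(k+1) = A x_i(k) + B u_i(k)` from the
initial states `x₀`, where `w i k` is the value at time `k` of the uncertainty in the input channel
of agent `i`. -/
def agentState {n N : ℕ} (A : Matrix (Fin n) (Fin n) ℝ) (B : Matrix (Fin n) (Fin 1) ℝ)
    (G : SimpleGraph (Fin N)) [DecidableRel G.Adj] (α : ℝ) (K : Matrix (Fin 1) (Fin n) ℝ)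
    (w : Fin N → ℕ → ℝ) (x₀ : Fin N → Fin n → ℝ) : ℕ → Fin N → Fin n → ℝ
  | 0 => x₀
  | k + 1 => fun i =>
      A *ᵥ agentState A B G α K w x₀ k i +
        B *ᵥ controlInput G α K (fun l => w l k) (agentState A B G α K w x₀ k) i

/-- The input channel uncertainties `Δ i k` (agent `i`, time `k`) are independent zero-mean white
noises, the one of agent `i` having variance `σ i ^ 2` at every time. -/
structure IsInputNoise {N : ℕ} {Ω : Type*} [MeasurableSpace Ω] (μ : Measure Ω)
    (Δ : Fin N → ℕ → Ω → ℝ) (σ : Fin N → ℝ) : Prop where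
  measurable : ∀ i k, Measurable (Δ i k)
  memLp : ∀ i k, MemLp (Δ i k) 2 μ
  indep : iIndepFun (fun p : Fin N × ℕ => Δ p.1 p.2) μ
  mean : ∀ i k, ∫ ω, Δ i k ω ∂μ = 0
  variance : ∀ i k, ∫ ω, (Δ i k ω) ^ 2 ∂μ = σ i ^ 2

/-- The protocol with scaling factor `α` and gain `K` solves the mean square consensus problem: for
all square integrable random initial states that are independent of the channel uncertainties (in
particular for all deterministic ones), `E ‖x_i(k) - x_j(k)‖²` is finite and tends to `0` for all
`i`, `j`. The norm is the Euclidean one. -/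
def SolvesMeanSquareConsensus {n N : ℕ} (A : Matrix (Fin n) (Fin n) ℝ)
    (B : Matrix (Fin n) (Fin 1) ℝ) (G : SimpleGraph (Fin N)) [DecidableRel G.Adj] (α : ℝ)
    (K : Matrix (Fin 1) (Fin n) ℝ) {Ω : Type*} [MeasurableSpace Ω] (μ : Measure Ω)
    (Δ : Fin N → ℕ → Ω → ℝ) : Prop :=
  ∀ x₀ : Ω → Fin N → Fin n → ℝ, Measurable x₀ → MemLp x₀ 2 μ →
    IndepFun x₀ (fun ω (p : Fin N × ℕ) => Δ p.1 p.2 ω) μ →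
    ∀ i j : Fin N,
      (∀ k, Integrable (fun ω =>
        ‖WithLp.toLp 2 (agentState A B G α K (fun l m => Δ l m ω) (x₀ ω) k i -
          agentState A B G α K (fun l m => Δ l m ω) (x₀ ω) k j)‖ ^ 2) μ) ∧
      Tendsto (fun k => ∫ ω,
        ‖WithLp.toLp 2 (agentState A B G α K (fun l m => Δ l m ω) (x₀ ω) k i -
          agentState A B G α K (fun l m => Δ l m ω) (x₀ ω) k j)‖ ^ 2 ∂μ) atTop (𝓝 0)

/-- The left-hand side `(α λ - 1)² + α² ϱ² λ²` of the consensus condition. -/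
def consensusBound (α ϱsq l : ℝ) : ℝ :=
  (α * l - 1) ^ 2 + α ^ 2 * ϱsq * l ^ 2

end

/-! Write b for the column of B and g = bᵀPb. The proof has a Riccati half, whose threshold is
M(A)², and a Lyapunov half for the network.

The Riccati map mixes the linear term (Ax)ᵀP(Ax) with the minimum of (Ax + tb)ᵀP(Ax + tb) + ρt² over
scalar inputs t, so it is monotone in P. Iterating it from 0 therefore converges as soon as some
supersolution exists. The supersolution comes from the regulator problem ρ = γ = 1 with state weight
ε: its solution satisfies the modified inequality whenever 1/(1 + g) ≤ (1 - δ²)/g, that is δ²(1 + g)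
≤ 1, and keeps a slack ε|x|² which absorbs any Q after scaling (`exists_modified_riccatiMap_le`). As
ε → 0, 1 + g tends to M(A)² (`exists_regulator_lt`): on the unit circle (1 + g)|c|² = |a|² for the
closed-loop and open-loop characteristic polynomials c and a, hence √(1 + g)·c and a have equal
Mahler measures, and c has measure 1 because its roots lie in the closed disc. Uniqueness holds
because for ρ = 0 the map without Q is homogeneous of degree one.

For consensus, the Lyapunov function is the expected sum of (x_i - x_j)ᵀP(x_i - x_j) over all pairs.
Independence and zero mean leave only the variances in its one-step change
(`integral_quadForm_step`). By the Riccati equation this change is bounded by minus the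
corresponding sum for Q, plus g times a scalar quadratic form in the signals K x_i. In a Laplacian
eigenbasis that form splits into modes with coefficients proportional to (αλ - 1)² + α²ϱ²λ² - δ².
The mode λ = 0 is the average, invisible in differences; convexity in λ reduces the others to λ₂ and
λ_N (`lapMatrix_disagreement_le`). So the sum decays geometrically. -/

/-! ### Quadratic forms and fixed points of the Riccati map. -/

section Riccati

variable {n : ℕ}

/-- The quadratic form `x ↦ xᵀ P x`. -/
def quadForm (P : Matrix (Fin n) (Fin n) ℝ) (x : Fin n → ℝ) : ℝ := x ⬝ᵥ P *ᵥ x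

lemma quadForm_zero_left (x : Fin n → ℝ) : quadForm 0 x = 0 := by simp [quadForm]

lemma quadForm_add_left (P Q : Matrix (Fin n) (Fin n) ℝ) (x : Fin n → ℝ) :
    quadForm (P + Q) x = quadForm P x + quadForm Q x := by
  simp [quadForm, add_mulVec, dotProduct_add]

lemma quadForm_smul_left (c : ℝ) (P : Matrix (Fin n) (Fin n) ℝ) (x : Fin n → ℝ) :
    quadForm (c • P) x = c * quadForm P x := by
  simp [quadForm, smul_mulVec, dotProduct_smul]

lemma quadForm_neg_left (P : Matrix (Fin n) (Fin n) ℝ) (x : Fin n → ℝ) :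
    quadForm (-P) x = -quadForm P x := by
  simp [quadForm, neg_mulVec]

lemma quadForm_sub_left (P Q : Matrix (Fin n) (Fin n) ℝ) (x : Fin n → ℝ) :
    quadForm (P - Q) x = quadForm P x - quadForm Q x := by
  simp [quadForm, sub_mulVec, dotProduct_sub]

lemma quadForm_sum_left {ι : Type*} (s : Finset ι) (P : ι → Matrix (Fin n) (Fin n) ℝ)
    (x : Fin n → ℝ) : quadForm (∑ i ∈ s, P i) x = ∑ i ∈ s, quadForm (P i) x := by
  simp [quadForm, sum_mulVec, dotProduct_sum]

lemma quadForm_smul_right (P : Matrix (Fin n) (Fin n) ℝ) (c : ℝ) (x : Fin n → ℝ) :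
    quadForm P (c • x) = c ^ 2 * quadForm P x := by
  simp [quadForm, mulVec_smul, dotProduct_smul]; ring

lemma quadForm_zero_right (P : Matrix (Fin n) (Fin n) ℝ) : quadForm P 0 = 0 := by simp [quadForm]

lemma dotProduct_mulVec_symm {P : Matrix (Fin n) (Fin n) ℝ} (hP : P.IsSymm) (x y : Fin n → ℝ) :
    x ⬝ᵥ P *ᵥ y = y ⬝ᵥ P *ᵥ x := by
  rw [dotProduct_mulVec, ← mulVec_transpose, hP.eq, dotProduct_comm]

lemma quadForm_add_right {P : Matrix (Fin n) (Fin n) ℝ} (hP : P.IsSymm) (x y : Fin n → ℝ) :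
    quadForm P (x + y) = quadForm P x + 2 * (x ⬝ᵥ P *ᵥ y) + quadForm P y := by
  simp only [quadForm, mulVec_add, dotProduct_add, add_dotProduct,
    dotProduct_mulVec_symm hP y x]
  ring

lemma quadForm_transpose_mul_mul (A P : Matrix (Fin n) (Fin n) ℝ) (x : Fin n → ℝ) :
    quadForm (Aᵀ * P * A) x = quadForm P (A *ᵥ x) := by
  simp only [quadForm]
  rw [mul_assoc, ← mulVec_mulVec, dotProduct_mulVec, vecMul_transpose, ← mulVec_mulVec]

lemma quadForm_vecMulVec (v x : Fin n → ℝ) : quadForm (vecMulVec v v) x = (v ⬝ᵥ x) ^ 2 := by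
  simp only [quadForm, vecMulVec_mulVec]
  simp [dotProduct_comm x v]; ring

lemma continuous_quadForm_right (P : Matrix (Fin n) (Fin n) ℝ) : Continuous (quadForm P) := by
  unfold quadForm; fun_prop

lemma continuous_quadForm_left (x : Fin n → ℝ) :
    Continuous (fun P : Matrix (Fin n) (Fin n) ℝ => quadForm P x) := by
  unfold quadForm; fun_prop

lemma Matrix.IsSymm.apply_eq_quadForm {R : Matrix (Fin n) (Fin n) ℝ} (hR : R.IsSymm)
    (i j : Fin n) : R i j = (quadForm R (Pi.single i 1 + Pi.single j 1) -
      quadForm R (Pi.single i 1) - quadForm R (Pi.single j 1)) / 2 := by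
  have h : (Pi.single i 1 : Fin n → ℝ) ⬝ᵥ R *ᵥ Pi.single j 1 = R i j := by simp
  rw [quadForm_add_right hR, h]
  ring

lemma Matrix.IsSymm.eq_of_quadForm {P Q : Matrix (Fin n) (Fin n) ℝ} (hP : P.IsSymm)
    (hQ : Q.IsSymm) (h : ∀ x, quadForm P x = quadForm Q x) : P = Q := by
  ext i j
  rw [hP.apply_eq_quadForm, hQ.apply_eq_quadForm, h, h, h]

lemma Matrix.PosDef.quadForm_pos {P : Matrix (Fin n) (Fin n) ℝ} (hP : P.PosDef) {x : Fin n → ℝ}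
    (hx : x ≠ 0) : 0 < quadForm P x := by
  simpa [quadForm] using hP.dotProduct_mulVec_pos hx

lemma Matrix.PosDef.quadForm_nonneg {P : Matrix (Fin n) (Fin n) ℝ} (hP : P.PosDef)
    (x : Fin n → ℝ) : 0 ≤ quadForm P x := by
  simpa [quadForm] using hP.posSemidef.dotProduct_mulVec_nonneg x

lemma Matrix.PosDef.isSymm {P : Matrix (Fin n) (Fin n) ℝ} (hP : P.PosDef) : P.IsSymm := by
  simpa [Matrix.IsHermitian, Matrix.IsSymm] using hP.isHermitian

lemma posDef_of_quadForm_pos {P : Matrix (Fin n) (Fin n) ℝ} (hP : P.IsSymm)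
    (h : ∀ x, x ≠ 0 → 0 < quadForm P x) : P.PosDef :=
  Matrix.PosDef.of_dotProduct_mulVec_pos
    (by simpa [Matrix.IsHermitian, Matrix.IsSymm] using hP) (by simpa [quadForm] using h)

/-- Every quadratic form is bounded by a multiple of a positive definite one. -/
lemma Matrix.PosDef.exists_quadForm_le {Q : Matrix (Fin n) (Fin n) ℝ} (hQ : Q.PosDef)
    (P : Matrix (Fin n) (Fin n) ℝ) : ∃ C, 0 < C ∧ ∀ x, quadForm P x ≤ C * quadForm Q x := by
  have hne : ∀ x ∈ Metric.sphere (0 : Fin n → ℝ) 1, quadForm Q x ≠ 0 := by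
    intro x hx
    refine (hQ.quadForm_pos ?_).ne'
    rintro rfl
    simp at hx
  -- Both forms are homogeneous of degree two, so it is enough to bound their ratio on the unit
  -- sphere.
  obtain ⟨C, hC⟩ := ((isCompact_sphere (0 : Fin n → ℝ) 1).bddAbove_image
    (((continuous_quadForm_right P).continuousOn).div
      (continuous_quadForm_right Q).continuousOn hne))
  refine ⟨max C 1, by positivity, fun x => ?_⟩
  by_cases hx : x = 0
  · simp [hx, quadForm_zero_right]
  have hxn : ‖x‖ ≠ 0 := norm_ne_zero_iff.2 hx
  have hs : (‖x‖⁻¹ • x) ∈ Metric.sphere (0 : Fin n → ℝ) 1 := by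
    simp [norm_smul, hxn]
  have h1 := hC ⟨_, hs, rfl⟩
  have h2 : quadForm P x ≤ C * quadForm Q x := by
    have hpos := hQ.quadForm_pos hx
    rw [Pi.div_apply, quadForm_smul_right, quadForm_smul_right] at h1
    rw [mul_div_mul_left _ _ (by positivity), div_le_iff₀ hpos] at h1
    exact h1
  exact h2.trans (mul_le_mul_of_nonneg_right (le_max_left _ _) (hQ.quadForm_nonneg x))

/-- A symmetric matrix sequence whose quadratic forms are monotone and bounded converges. -/
lemma exists_tendsto_of_monotone_quadForm {P : ℕ → Matrix (Fin n) (Fin n) ℝ}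
    (hP : ∀ k, (P k).IsSymm) (hmono : ∀ x, Monotone fun k => quadForm (P k) x)
    (hbdd : ∀ x, BddAbove (Set.range fun k => quadForm (P k) x)) :
    ∃ L : Matrix (Fin n) (Fin n) ℝ, L.IsSymm ∧ Tendsto P atTop (𝓝 L) := by
  have hq : ∀ x, ∃ l, Tendsto (fun k => quadForm (P k) x) atTop (𝓝 l) := fun x =>
    ⟨_, tendsto_atTop_ciSup (hmono x) (hbdd x)⟩
  choose l hl using hq
  have ht : Tendsto P atTop (𝓝 (Matrix.of fun i j =>
      (l (Pi.single i 1 + Pi.single j 1) - l (Pi.single i 1) - l (Pi.single j 1)) / 2)) := by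
    refine tendsto_pi_nhds.2 fun i => tendsto_pi_nhds.2 fun j => ?_
    simp only [(hP _).apply_eq_quadForm i j]
    exact (((hl _).sub (hl _)).sub (hl _)).div_const 2
  refine ⟨_, ?_, ht⟩
  have h2 : Tendsto (fun k => (P k)ᵀ) atTop _ := (continuous_id.matrix_transpose.tendsto _).comp ht
  simp only [(hP _).eq] at h2
  exact tendsto_nhds_unique h2 ht

/-- The Riccati map with scalar input direction `b`, input weight `ρ`, correction factor `γ` and
state weight `Q`. -/
noncomputable def riccatiMap (A : Matrix (Fin n) (Fin n) ℝ) (b : Fin n → ℝ) (ρ γ : ℝ)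
    (Q P : Matrix (Fin n) (Fin n) ℝ) : Matrix (Fin n) (Fin n) ℝ :=
  Aᵀ * P * A - (γ / (ρ + quadForm P b)) • vecMulVec (Aᵀ *ᵥ P *ᵥ b) (Aᵀ *ᵥ P *ᵥ b) + Q

variable {A : Matrix (Fin n) (Fin n) ℝ} {b : Fin n → ℝ} {ρ γ : ℝ}

lemma riccatiMap_isSymm {Q P : Matrix (Fin n) (Fin n) ℝ} (hQ : Q.IsSymm) (hP : P.IsSymm) :
    (riccatiMap A b ρ γ Q P).IsSymm := by
  simp only [riccatiMap, Matrix.IsSymm, transpose_add, transpose_sub, transpose_mul,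
    transpose_smul, transpose_transpose, hQ.eq, hP.eq, Matrix.transpose_vecMulVec, mul_assoc]

lemma quadForm_riccatiMap {P : Matrix (Fin n) (Fin n) ℝ} (hP : P.IsSymm)
    (Q : Matrix (Fin n) (Fin n) ℝ) (x : Fin n → ℝ) :
    quadForm (riccatiMap A b ρ γ Q P) x =
      quadForm P (A *ᵥ x) - γ / (ρ + quadForm P b) * (b ⬝ᵥ P *ᵥ (A *ᵥ x)) ^ 2 + quadForm Q x := by
  rw [riccatiMap, quadForm_add_left, quadForm_sub_left, quadForm_smul_left, quadForm_vecMulVec,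
    quadForm_transpose_mul_mul]
  congr 4
  rw [mulVec_transpose, ← dotProduct_mulVec, dotProduct_comm, dotProduct_mulVec_symm hP,
    dotProduct_mulVec, ← dotProduct_mulVec]

/-- Degenerate Cauchy–Schwarz: P is nonnegative along the line s b + y, where its form is affine in
s, so the slope vanishes. This makes the value 0 of a division by bᵀPb = 0 harmless. -/
lemma dotProduct_eq_zero_of_quadForm_eq_zero {P : Matrix (Fin n) (Fin n) ℝ} (hP : P.IsSymm)
    (hP0 : ∀ x, 0 ≤ quadForm P x) (hb : quadForm P b = 0) (y : Fin n → ℝ) :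
    b ⬝ᵥ P *ᵥ y = 0 := by
  have h : ∀ s : ℝ, 0 ≤ quadForm P y + 2 * s * (b ⬝ᵥ P *ᵥ y) := by
    intro s
    have := hP0 (s • b + y)
    rw [quadForm_add_right hP, quadForm_smul_right, hb, smul_dotProduct, smul_eq_mul] at this
    linarith
  by_contra hne
  have := h (-(quadForm P y + 1) / (2 * (b ⬝ᵥ P *ᵥ y)))
  have e : 2 * (-(quadForm P y + 1) / (2 * (b ⬝ᵥ P *ᵥ y))) * (b ⬝ᵥ P *ᵥ y) =
      -(quadForm P y + 1) := by field_simp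
  linarith

/-- The quadratic form obtained by minimising `(y + t b)ᵀ P (y + t b) + ρ t²` over `t`. -/
lemma sub_div_le_quadForm_add {P : Matrix (Fin n) (Fin n) ℝ} (hP : P.IsSymm)
    (hP0 : ∀ x, 0 ≤ quadForm P x) (hρ : 0 ≤ ρ) (y : Fin n → ℝ) (t : ℝ) :
    quadForm P y - 1 / (ρ + quadForm P b) * (b ⬝ᵥ P *ᵥ y) ^ 2 ≤
      quadForm P (y + t • b) + ρ * t ^ 2 := by
  rw [quadForm_add_right hP, quadForm_smul_right, mulVec_smul, dotProduct_smul, smul_eq_mul,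
    dotProduct_mulVec_symm hP y b]
  rcases (add_nonneg hρ (hP0 b)).eq_or_lt with h | h
  · have hb : quadForm P b = 0 := by linarith [hP0 b]
    rw [dotProduct_eq_zero_of_quadForm_eq_zero hP hP0 hb, hb]
    nlinarith [sq_nonneg t]
  -- Completing the square in t.
  · have : 0 ≤ (ρ + quadForm P b) * (t + (b ⬝ᵥ P *ᵥ y) / (ρ + quadForm P b)) ^ 2 := by positivity
    have e : (ρ + quadForm P b) * (t + (b ⬝ᵥ P *ᵥ y) / (ρ + quadForm P b)) ^ 2 =
      (ρ + quadForm P b) * t ^ 2 + 2 * t * (b ⬝ᵥ P *ᵥ y) +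
        1 / (ρ + quadForm P b) * (b ⬝ᵥ P *ᵥ y) ^ 2 := by field_simp; ring
    linarith

lemma exists_quadForm_add_eq {P : Matrix (Fin n) (Fin n) ℝ} (hP : P.IsSymm)
    (hP0 : ∀ x, 0 ≤ quadForm P x) (hρ : 0 ≤ ρ) (y : Fin n → ℝ) :
    ∃ t : ℝ, quadForm P (y + t • b) + ρ * t ^ 2 =
      quadForm P y - 1 / (ρ + quadForm P b) * (b ⬝ᵥ P *ᵥ y) ^ 2 := by
  rcases (add_nonneg hρ (hP0 b)).eq_or_lt with h | h
  · have hb : quadForm P b = 0 := by linarith [hP0 b]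
    refine ⟨0, ?_⟩
    rw [dotProduct_eq_zero_of_quadForm_eq_zero hP hP0 hb]
    simp
  · refine ⟨-(b ⬝ᵥ P *ᵥ y) / (ρ + quadForm P b), ?_⟩
    rw [quadForm_add_right hP, quadForm_smul_right, mulVec_smul, dotProduct_smul, smul_eq_mul,
      dotProduct_mulVec_symm hP y b]
    field_simp
    ring

/-- The form is (1 - γ) times a term linear in P, plus γ times a minimum over t of terms linear in
P, plus Q. Evaluating the P₁ problem at the minimiser t for P₂ compares the two minima. -/
lemma quadForm_riccatiMap_mono (hρ : 0 ≤ ρ) (hγ0 : 0 ≤ γ) (hγ1 : γ ≤ 1)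
    (Q : Matrix (Fin n) (Fin n) ℝ) {P₁ P₂ : Matrix (Fin n) (Fin n) ℝ} (h1 : P₁.IsSymm)
    (h2 : P₂.IsSymm) (h10 : ∀ x, 0 ≤ quadForm P₁ x) (h12 : ∀ x, quadForm P₁ x ≤ quadForm P₂ x)
    (x : Fin n → ℝ) :
    quadForm (riccatiMap A b ρ γ Q P₁) x ≤ quadForm (riccatiMap A b ρ γ Q P₂) x := by
  obtain ⟨t, ht⟩ := exists_quadForm_add_eq (b := b) h2 (fun x => (h10 x).trans (h12 x)) hρ (A *ᵥ x)
  have hle := sub_div_le_quadForm_add (b := b) h1 h10 hρ (A *ᵥ x) t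
  have hle2 : quadForm P₁ (A *ᵥ x) - 1 / (ρ + quadForm P₁ b) * (b ⬝ᵥ P₁ *ᵥ A *ᵥ x) ^ 2 ≤
      quadForm P₂ (A *ᵥ x) - 1 / (ρ + quadForm P₂ b) * (b ⬝ᵥ P₂ *ᵥ A *ᵥ x) ^ 2 := by
    rw [← ht]
    exact hle.trans (by linarith [h12 (A *ᵥ x + t • b)])
  rw [quadForm_riccatiMap h1, quadForm_riccatiMap h2]
  have e : ∀ p g c : ℝ, p - γ / g * c = (1 - γ) * p + γ * (p - 1 / g * c) := by
    intro p g c; ring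
  rw [e, e]
  have := mul_le_mul_of_nonneg_left hle2 hγ0
  have := mul_le_mul_of_nonneg_left (h12 (A *ᵥ x)) (sub_nonneg.2 hγ1)
  linarith

lemma quadForm_le_riccatiMap (hρ : 0 ≤ ρ) (hγ0 : 0 ≤ γ) (hγ1 : γ ≤ 1)
    (Q : Matrix (Fin n) (Fin n) ℝ) {P : Matrix (Fin n) (Fin n) ℝ} (hP : P.IsSymm)
    (hP0 : ∀ x, 0 ≤ quadForm P x) (x : Fin n → ℝ) :
    quadForm Q x ≤ quadForm (riccatiMap A b ρ γ Q P) x := by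
  have h := quadForm_riccatiMap_mono (A := A) (b := b) hρ hγ0 hγ1 Q (P₁ := 0) (P₂ := P)
    (by simp [Matrix.IsSymm]) hP (by simp [quadForm_zero_left])
    (by simpa [quadForm_zero_left] using hP0) x
  rw [quadForm_riccatiMap (by simp [Matrix.IsSymm])] at h
  simpa [quadForm_zero_left] using h

lemma continuousAt_riccatiMap {P : Matrix (Fin n) (Fin n) ℝ} (Q : Matrix (Fin n) (Fin n) ℝ)
    (h : ρ + quadForm P b ≠ 0 ∨ b = 0) : ContinuousAt (riccatiMap A b ρ γ Q) P := by
  have h1 : Continuous fun P : Matrix (Fin n) (Fin n) ℝ => Aᵀ * P * A := by fun_prop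
  have h2 : Continuous fun P : Matrix (Fin n) (Fin n) ℝ =>
      vecMulVec (Aᵀ *ᵥ P *ᵥ b) (Aᵀ *ᵥ P *ᵥ b) := by
    have : Continuous fun P : Matrix (Fin n) (Fin n) ℝ => Aᵀ *ᵥ P *ᵥ b := by fun_prop
    exact this.matrix_vecMulVec this
  rcases h with h | rfl
  · have h3 : ContinuousAt (fun P => γ / (ρ + quadForm P b)) P :=
      continuousAt_const.div
        (continuousAt_const.add (continuous_quadForm_left b).continuousAt) h
    exact (h1.continuousAt.sub (h3.smul h2.continuousAt)).add continuousAt_const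
  · unfold riccatiMap
    simp only [mulVec_zero, zero_vecMulVec, smul_zero, sub_zero]
    exact (h1.add continuous_const).continuousAt

/-- If the Riccati inequality has a positive semidefinite solution, then the Riccati equation has a
positive definite solution below all solutions of the inequality. -/
theorem exists_least_riccatiMap_fixedPoint (hρ : 0 ≤ ρ) (hγ0 : 0 ≤ γ) (hγ1 : γ ≤ 1)
    {Q : Matrix (Fin n) (Fin n) ℝ} (hQ : Q.PosDef)
    (hsuper : ∃ S : Matrix (Fin n) (Fin n) ℝ, S.IsSymm ∧ (∀ x, 0 ≤ quadForm S x) ∧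
      ∀ x, quadForm (riccatiMap A b ρ γ Q S) x ≤ quadForm S x) :
    ∃ P : Matrix (Fin n) (Fin n) ℝ, P.PosDef ∧ riccatiMap A b ρ γ Q P = P ∧
      ∀ S : Matrix (Fin n) (Fin n) ℝ, S.IsSymm → (∀ x, 0 ≤ quadForm S x) →
        (∀ x, quadForm (riccatiMap A b ρ γ Q S) x ≤ quadForm S x) →
          ∀ x, quadForm P x ≤ quadForm S x := by
  -- Value iteration from 0: increasing, and below every supersolution.
  let p : ℕ → Matrix (Fin n) (Fin n) ℝ := fun k => (riccatiMap A b ρ γ Q)^[k] 0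
  have hsucc : ∀ k, p (k + 1) = riccatiMap A b ρ γ Q (p k) := fun k =>
    Function.iterate_succ_apply' _ _ _
  have hsymm : ∀ k, (p k).IsSymm := by
    intro k
    induction k with
    | zero => simp [p, Matrix.IsSymm]
    | succ k ih => rw [hsucc]; exact riccatiMap_isSymm hQ.isSymm ih
  have hnn : ∀ k x, 0 ≤ quadForm (p k) x := by
    intro k
    induction k with
    | zero => simp [p, quadForm_zero_left]
    | succ k ih =>
      intro x
      rw [hsucc]
      exact (hQ.quadForm_nonneg x).trans (quadForm_le_riccatiMap hρ hγ0 hγ1 Q (hsymm k) ih x)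
  have hstep : ∀ k x, quadForm (p k) x ≤ quadForm (p (k + 1)) x := by
    intro k
    induction k with
    | zero => intro x; simpa [p, quadForm_zero_left] using hnn 1 x
    | succ k ih =>
      intro x
      rw [hsucc (k + 1)]
      conv_lhs => rw [hsucc k]
      exact quadForm_riccatiMap_mono hρ hγ0 hγ1 Q (hsymm _) (hsymm _) (hnn _) ih x
  have hle : ∀ S : Matrix (Fin n) (Fin n) ℝ, S.IsSymm → (∀ x, 0 ≤ quadForm S x) →
      (∀ x, quadForm (riccatiMap A b ρ γ Q S) x ≤ quadForm S x) →
        ∀ k x, quadForm (p k) x ≤ quadForm S x := by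
    intro S hS hS0 hS1 k
    induction k with
    | zero => simpa [p, quadForm_zero_left] using hS0
    | succ k ih =>
      intro x
      rw [hsucc]
      exact (quadForm_riccatiMap_mono hρ hγ0 hγ1 Q (hsymm _) hS (hnn _) ih x).trans (hS1 x)
  obtain ⟨S, hS, hS0, hS1⟩ := hsuper
  obtain ⟨P, hP, hlim⟩ := exists_tendsto_of_monotone_quadForm hsymm
    (fun x => monotone_nat_of_le_succ fun k => hstep k x)
    (fun x => ⟨quadForm S x, by rintro _ ⟨k, rfl⟩; exact hle S hS hS0 hS1 k x⟩)
  have hq : ∀ x, Tendsto (fun k => quadForm (p k) x) atTop (𝓝 (quadForm P x)) := fun x =>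
    ((continuous_quadForm_left x).tendsto P).comp hlim
  -- All iterates after the initial 0 dominate Q, hence so does the limit. This gives definiteness,
  -- and a nonzero denominator at P unless b = 0, as continuity requires.
  have hQP : ∀ x, quadForm Q x ≤ quadForm P x := by
    intro x
    refine ge_of_tendsto (hq x) ?_
    filter_upwards [eventually_ge_atTop 1] with k hk
    obtain ⟨k, rfl⟩ := Nat.exists_eq_add_of_le' hk
    rw [hsucc]
    exact quadForm_le_riccatiMap hρ hγ0 hγ1 Q (hsymm k) (hnn k) x
  have hPD : P.PosDef := posDef_of_quadForm_pos hP fun x hx => (hQ.quadForm_pos hx).trans_le (hQP x)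
  refine ⟨P, hPD, ?_, fun S hS hS0 hS1 x =>
    le_of_tendsto' (hq x) fun k => hle S hS hS0 hS1 k x⟩
  have hc : ContinuousAt (riccatiMap A b ρ γ Q) P := by
    refine continuousAt_riccatiMap Q ?_
    by_cases hb : b = 0
    · exact Or.inr hb
    · exact Or.inl (by linarith [hPD.quadForm_pos hb])
  have h1 := hc.tendsto.comp hlim
  have h2 : Tendsto (fun k => p (k + 1)) atTop (𝓝 P) := (tendsto_add_atTop_iff_nat 1).2 hlim
  refine tendsto_nhds_unique (h1.congr fun k => ?_) h2
  rw [hsucc]; rfl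

/-- With ρ = 0 the correction term has numerator of degree two and denominator of degree one in P.
-/
lemma quadForm_riccatiMap_smul {P : Matrix (Fin n) (Fin n) ℝ} (hP : P.IsSymm)
    (Q : Matrix (Fin n) (Fin n) ℝ) (c : ℝ) (x : Fin n → ℝ) :
    quadForm (riccatiMap A b 0 γ Q (c • P)) x =
      c * quadForm (riccatiMap A b 0 γ 0 P) x + quadForm Q x := by
  rw [quadForm_riccatiMap (hP.smul c), quadForm_riccatiMap hP]
  simp only [quadForm_smul_left, quadForm_zero_left, smul_mulVec, dotProduct_smul, smul_eq_mul,
    zero_add]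
  rcases eq_or_ne c 0 with rfl | hc
  · simp
  · rw [mul_pow, div_mul_eq_mul_div, div_mul_eq_mul_div,
      show γ * (c ^ 2 * (b ⬝ᵥ P *ᵥ A *ᵥ x) ^ 2) = c * (c * (γ * (b ⬝ᵥ P *ᵥ A *ᵥ x) ^ 2)) by ring,
      mul_div_mul_left _ _ hc]
    ring

/-- If s P₁ ≤ P₂ with 0 ≤ s ≤ 1, applying the map gives s P₁ + (1 - s) Q ≤ P₂. Since Q ≥ D⁻¹ P₁, the
gap 1 - s can be multiplied by 1 - D⁻¹; iterating from s = 0 gives P₁ ≤ P₂. -/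
lemma riccatiMap_fixedPoint_le (hγ0 : 0 ≤ γ) (hγ1 : γ ≤ 1) {Q P₁ P₂ : Matrix (Fin n) (Fin n) ℝ}
    (hQ : Q.PosDef) (h1 : P₁.PosDef) (h2 : P₂.PosDef) (e1 : riccatiMap A b 0 γ Q P₁ = P₁)
    (e2 : riccatiMap A b 0 γ Q P₂ = P₂) (x : Fin n → ℝ) : quadForm P₁ x ≤ quadForm P₂ x := by
  obtain ⟨C, hC, hC'⟩ := hQ.exists_quadForm_le P₁
  let D := max C 1
  have hD : 1 ≤ D := le_max_right _ _
  have hD' : ∀ x, quadForm P₁ x ≤ D * quadForm Q x := fun x =>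
    (hC' x).trans (mul_le_mul_of_nonneg_right (le_max_left _ _) (hQ.quadForm_nonneg x))
  have hη0 : 0 < D⁻¹ := by positivity
  have hη1 : D⁻¹ ≤ 1 := inv_le_one_of_one_le₀ hD
  have key : ∀ k : ℕ, ∀ x, quadForm ((1 - (1 - D⁻¹) ^ k) • P₁) x ≤ quadForm P₂ x := by
    intro k
    induction k with
    | zero => intro x; simpa [quadForm_zero_left] using h2.quadForm_nonneg x
    | succ k ih =>
      intro x
      have ht1 : (1 - D⁻¹) ^ k ≤ 1 := pow_le_one₀ (by linarith) (by linarith)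
      have ht0 : 0 ≤ (1 - D⁻¹) ^ k := pow_nonneg (by linarith) _
      have hm := quadForm_riccatiMap_mono (A := A) (b := b) le_rfl hγ0 hγ1 Q
        (h1.isSymm.smul (1 - (1 - D⁻¹) ^ k)) h2.isSymm
        (fun x => by
          rw [quadForm_smul_left]
          exact mul_nonneg (by linarith) (h1.quadForm_nonneg x)) ih x
      rw [e2, quadForm_riccatiMap_smul h1.isSymm] at hm
      have h3 := quadForm_riccatiMap_smul (A := A) (b := b) (γ := γ) h1.isSymm Q 1 x
      rw [one_smul, e1, one_mul] at h3
      rw [quadForm_smul_left]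
      have h4 : D⁻¹ * quadForm P₁ x ≤ quadForm Q x := by
        rw [inv_mul_le_iff₀ (by positivity)]; exact hD' x
      have h5 := mul_le_mul_of_nonneg_left h4 ht0
      rw [pow_succ]
      nlinarith
  have hlim : Tendsto (fun k : ℕ => quadForm ((1 - (1 - D⁻¹) ^ k) • P₁) x) atTop
      (𝓝 (quadForm P₁ x)) := by
    simp only [quadForm_smul_left]
    have := tendsto_pow_atTop_nhds_zero_of_lt_one (r := 1 - D⁻¹) (by linarith) (by linarith)
    simpa using (this.const_sub 1).mul_const (quadForm P₁ x)
  exact le_of_tendsto' hlim fun k => key k x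

end Riccati

/-! ### Lyapunov functions, the regulator closed loop and the return difference. -/

section ClosedLoop

variable {n : ℕ}

open scoped Matrix.Norms.L2Operator in
/-- Powers of a complex matrix whose eigenvalues lie in the open unit disc tend to zero. -/
lemma tendsto_norm_pow_of_spectrum_lt_one (M : Matrix (Fin n) (Fin n) ℂ)
    (hM : ∀ z ∈ spectrum ℂ M, ‖z‖ < 1) : Tendsto (fun k : ℕ => ‖M ^ k‖) atTop (𝓝 0) := by
  have hr : spectralRadius ℂ M < 1 := by
    rcases (spectrum ℂ M).eq_empty_or_nonempty with h | h
    · simp [spectralRadius, h]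
    · exact_mod_cast spectrum.spectralRadius_lt_of_forall_lt_of_nonempty h
        (r := 1) fun z hz => by exact_mod_cast hM z hz
  obtain ⟨r, hr1, hr2⟩ := ENNReal.lt_iff_exists_nnreal_btwn.1 hr
  -- Gelfand's formula: eventually the k-th power has norm at most r ^ k with r < 1.
  have hev := (spectrum.pow_nnnorm_pow_one_div_tendsto_nhds_spectralRadius M).eventually_lt_const hr1
  have hr3 : r < 1 := by exact_mod_cast hr2
  refine squeeze_zero' (Eventually.of_forall fun k => norm_nonneg _) ?_
    (tendsto_pow_atTop_nhds_zero_of_lt_one r.2 (by exact_mod_cast hr3))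
  filter_upwards [hev, eventually_gt_atTop 0] with k hk hk0
  have h1 : ((‖M ^ k‖₊ : ENNReal) ^ (1 / k : ℝ)) ^ (k : ℝ) ≤ (r : ENNReal) ^ (k : ℝ) :=
    ENNReal.rpow_le_rpow hk.le (by positivity)
  rw [← ENNReal.rpow_mul, one_div_mul_cancel (by positivity), ENNReal.rpow_one,
    ENNReal.rpow_natCast] at h1
  exact_mod_cast h1

open scoped Matrix.Norms.L2Operator in
/-- A Schur stable matrix has a power that contracts the Euclidean norm. -/
lemma exists_pow_dotProduct_le (F : Matrix (Fin n) (Fin n) ℝ)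
    (hF : ∀ z ∈ spectrum ℂ (F.map (fun r : ℝ => (r : ℂ))), ‖z‖ < 1) :
    ∃ m : ℕ, ∀ x : Fin n → ℝ, (F ^ m *ᵥ x) ⬝ᵥ (F ^ m *ᵥ x) ≤ 1 / 2 * (x ⬝ᵥ x) := by
  obtain ⟨m, hm⟩ := ((tendsto_norm_pow_of_spectrum_lt_one _ hF).eventually_lt_const
    (show (0 : ℝ) < 1 / 2 by norm_num)).exists
  refine ⟨m, fun x => ?_⟩
  have hpow : (F.map (fun r : ℝ => (r : ℂ))) ^ m = (F ^ m).map (fun r : ℝ => (r : ℂ)) :=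
    (map_pow (Complex.ofRealHom.mapMatrix) F m).symm
  rw [hpow] at hm
  have hn : ∀ y : Fin n → ℝ, ‖WithLp.toLp 2 (fun i => (y i : ℂ))‖ ^ 2 = y ⬝ᵥ y := by
    intro y
    rw [EuclideanSpace.norm_sq_eq]
    simp [dotProduct, sq]
  have h1 := Matrix.l2_opNorm_mulVec ((F ^ m).map (fun r : ℝ => (r : ℂ)))
    (WithLp.toLp 2 (fun i => (x i : ℂ)))
  have h2 : ((F ^ m).map (fun r : ℝ => (r : ℂ))) *ᵥ (fun i => (x i : ℂ)) =
      fun i => (((F ^ m *ᵥ x) i : ℝ) : ℂ) := by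
    ext i; simp [mulVec, dotProduct]
  have h3 : ‖WithLp.toLp 2 (fun i => (((F ^ m *ᵥ x) i : ℝ) : ℂ))‖ ≤
      ‖(F ^ m).map (fun r : ℝ => (r : ℂ))‖ * ‖WithLp.toLp 2 (fun i => (x i : ℂ))‖ := by
    rw [← h2]; exact h1
  rw [← hn, ← hn]
  have h4 : ‖WithLp.toLp 2 (fun i => (((F ^ m *ᵥ x) i : ℝ) : ℂ))‖ ≤
      1 / 2 * ‖WithLp.toLp 2 (fun i => (x i : ℂ))‖ :=
    h3.trans (mul_le_mul_of_nonneg_right hm.le (norm_nonneg _))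
  have h5 := pow_le_pow_left₀ (norm_nonneg _) h4 2
  nlinarith [sq_nonneg ‖WithLp.toLp 2 (fun i => (x i : ℂ))‖]

/-- A Schur stable matrix admits a quadratic Lyapunov function. -/
lemma exists_lyapunov (F : Matrix (Fin n) (Fin n) ℝ)
    (hF : ∀ z ∈ spectrum ℂ (F.map (fun r : ℝ => (r : ℂ))), ‖z‖ < 1) :
    ∃ X : Matrix (Fin n) (Fin n) ℝ, X.IsSymm ∧ (∀ x, 0 ≤ quadForm X x) ∧
      ∀ x, quadForm X (F *ᵥ x) + 1 / 2 * (x ⬝ᵥ x) ≤ quadForm X x := by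
  obtain ⟨m, hm⟩ := exists_pow_dotProduct_le F hF
  have hq : ∀ k x, quadForm ((F ^ k)ᵀ * F ^ k) x = (F ^ k *ᵥ x) ⬝ᵥ (F ^ k *ᵥ x) := by
    intro k x
    have := quadForm_transpose_mul_mul (F ^ k) 1 x
    rw [mul_one] at this
    rw [this, quadForm, one_mulVec]
  -- The sum of |F^k x|² over k < m telescopes along F: its change is |F^m x|² - |x|² ≤ -|x|²/2.
  refine ⟨∑ k ∈ Finset.range m, (F ^ k)ᵀ * F ^ k, ?_, ?_, ?_⟩
  · rw [Matrix.IsSymm, transpose_sum]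
    exact Finset.sum_congr rfl fun k _ => by simp
  · intro x
    rw [quadForm_sum_left]
    refine Finset.sum_nonneg fun k _ => ?_
    rw [hq]
    exact Finset.sum_nonneg fun i _ => mul_self_nonneg _
  · intro x
    simp only [quadForm_sum_left, hq, mulVec_mulVec, ← pow_succ]
    have h := Finset.sum_range_succ' (fun k => (F ^ k *ᵥ x) ⬝ᵥ (F ^ k *ᵥ x)) m
    rw [Finset.sum_range_succ] at h
    simp only [pow_zero, one_mulVec] at h
    linarith [hm x]

lemma vecMulVec_mulVec_eq (u v x : Fin n → ℝ) : vecMulVec u v *ᵥ x = (v ⬝ᵥ x) • u := by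
  ext i; simp [vecMulVec_mulVec, mul_comm]

/-- The linear quadratic regulator inequality is solvable for a stabilizable pair. -/
lemma exists_riccatiMap_le_of_schur {A : Matrix (Fin n) (Fin n) ℝ} {b κ : Fin n → ℝ}
    (hF : ∀ z ∈ spectrum ℂ ((A + vecMulVec b κ).map (fun r : ℝ => (r : ℂ))), ‖z‖ < 1)
    (Q : Matrix (Fin n) (Fin n) ℝ) :
    ∃ S : Matrix (Fin n) (Fin n) ℝ, S.IsSymm ∧ (∀ x, 0 ≤ quadForm S x) ∧
      ∀ x, quadForm (riccatiMap A b 1 1 Q S) x ≤ quadForm S x := by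
  obtain ⟨X, hX, hX0, hX1⟩ := exists_lyapunov _ hF
  obtain ⟨C, hC, hC1⟩ := (Matrix.PosDef.one (n := Fin n) (R := ℝ)).exists_quadForm_le
    (vecMulVec κ κ + Q)
  have hS0 : ∀ x, 0 ≤ quadForm ((2 * C) • X) x := fun x => by
    rw [quadForm_smul_left]; exact mul_nonneg (by positivity) (hX0 x)
  -- X decreases by |x|²/2, so 2C X decreases by C|x|², which pays for (κ ⬝ᵥ x)² and Q. The
  -- stabilizing input t = κ ⬝ᵥ x then bounds the minimum over t.
  refine ⟨(2 * C) • X, hX.smul _, hS0, fun x => ?_⟩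
  rw [quadForm_riccatiMap (hX.smul _)]
  have h1 := sub_div_le_quadForm_add (b := b) (hX.smul (2 * C)) hS0 zero_le_one (A *ᵥ x) (κ ⬝ᵥ x)
  have h2 := hX1 x
  have h3 := hC1 x
  rw [quadForm_add_left, quadForm_vecMulVec] at h3
  rw [add_mulVec, vecMulVec_mulVec_eq] at h2
  simp only [quadForm, one_mulVec] at h3
  simp only [quadForm_smul_left] at h1 ⊢
  simp only [quadForm] at h1 h2 ⊢
  nlinarith

/-- The closed loop matrix of the linear quadratic regulator with unit input weight. -/
noncomputable def closedLoop (A : Matrix (Fin n) (Fin n) ℝ) (b : Fin n → ℝ)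
    (P : Matrix (Fin n) (Fin n) ℝ) : Matrix (Fin n) (Fin n) ℝ :=
  A - (1 / (1 + quadForm P b)) • vecMulVec b (Aᵀ *ᵥ P *ᵥ b)

variable {A : Matrix (Fin n) (Fin n) ℝ} {b : Fin n → ℝ}

lemma transpose_mulVec_mulVec_dotProduct {P : Matrix (Fin n) (Fin n) ℝ} (hP : P.IsSymm)
    (x : Fin n → ℝ) : (Aᵀ *ᵥ P *ᵥ b) ⬝ᵥ x = b ⬝ᵥ P *ᵥ A *ᵥ x := by
  rw [mulVec_transpose, ← dotProduct_mulVec, dotProduct_comm, dotProduct_mulVec_symm hP,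
    dotProduct_mulVec, ← dotProduct_mulVec]

lemma closedLoop_mulVec {P : Matrix (Fin n) (Fin n) ℝ} (hP : P.IsSymm) (x : Fin n → ℝ) :
    closedLoop A b P *ᵥ x =
      A *ᵥ x + (-(1 / (1 + quadForm P b) * (b ⬝ᵥ P *ᵥ A *ᵥ x))) • b := by
  rw [closedLoop, sub_mulVec, smul_mulVec, vecMulVec_mulVec_eq,
    transpose_mulVec_mulVec_dotProduct hP, smul_smul, neg_smul, sub_eq_add_neg]

/-- Substituting the optimal input, the decrease is exactly the state cost Q plus the squared input.
-/
lemma quadForm_closedLoop_le {P Q : Matrix (Fin n) (Fin n) ℝ} (hP : P.IsSymm)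
    (hP0 : ∀ x, 0 ≤ quadForm P x) (hQ0 : ∀ x, 0 ≤ quadForm Q x)
    (hfix : riccatiMap A b 1 1 Q P = P) (x : Fin n → ℝ) :
    quadForm P (closedLoop A b P *ᵥ x) ≤ quadForm P x := by
  have h1 := quadForm_riccatiMap (A := A) (b := b) (ρ := 1) (γ := 1) hP Q x
  rw [hfix] at h1
  have hg : 0 < 1 + quadForm P b := by linarith [hP0 b]
  rw [closedLoop_mulVec hP, quadForm_add_right hP, quadForm_smul_right, mulVec_smul,
    dotProduct_smul, smul_eq_mul, dotProduct_mulVec_symm hP (A *ᵥ x) b]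
  set y := b ⬝ᵥ P *ᵥ A *ᵥ x
  set g := quadForm P b
  have h2 : (-(1 / (1 + g) * y)) ^ 2 * g ≤ (1 / (1 + g) * y) ^ 2 * (1 + g) := by
    nlinarith [sq_nonneg (1 / (1 + g) * y)]
  have h3 : (1 / (1 + g) * y) ^ 2 * (1 + g) = 1 / (1 + g) * y ^ 2 := by field_simp
  have h4 : 2 * (-(1 / (1 + g) * y) * y) = - 2 * (1 / (1 + g) * y ^ 2) := by ring
  linarith [hQ0 x]

/-- A matrix that does not increase a positive definite form has its eigenvalues in the closed
unit disc. -/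
lemma norm_le_one_of_isRoot_charpoly {F P : Matrix (Fin n) (Fin n) ℝ} (hP : P.PosDef)
    (h : ∀ x, quadForm P (F *ᵥ x) ≤ quadForm P x) {z : ℂ}
    (hz : (F.map (fun r : ℝ => (r : ℂ))).charpoly.IsRoot z) : ‖z‖ ≤ 1 := by
  rw [Polynomial.IsRoot, eval_charpoly] at hz
  obtain ⟨v, hv0, hv⟩ := exists_mulVec_eq_zero_iff.2 hz
  have hv' : ∀ i, ∑ j, (F i j : ℂ) * v j = z * v i := by
    intro i
    have := congrFun hv i
    simp only [sub_mulVec, Pi.sub_apply, Pi.zero_apply, sub_eq_zero] at this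
    simpa [mulVec, dotProduct, Matrix.scalar_apply, diagonal_apply] using this.symm
  -- On the real and imaginary parts of an eigenvector, F acts as a rotation scaled by |z|; in the
  -- sum of the two forms the cross terms cancel.
  let x : Fin n → ℝ := fun i => (v i).re
  let y : Fin n → ℝ := fun i => (v i).im
  have hx : F *ᵥ x = z.re • x + (-z.im) • y := by
    ext i
    have := congrArg Complex.re (hv' i)
    simpa [mulVec, dotProduct, x, y, sub_eq_add_neg] using this
  have hy : F *ᵥ y = z.im • x + z.re • y := by
    ext i
    have := congrArg Complex.im (hv' i)
    simp only [Complex.im_sum, Complex.mul_im, Complex.ofReal_re, Complex.ofReal_im, zero_mul,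
      add_zero] at this
    simp only [mulVec, dotProduct, x, y, Pi.add_apply, Pi.smul_apply, smul_eq_mul]
    linarith
  have h1 := h x
  have h2 := h y
  rw [hx] at h1
  rw [hy] at h2
  simp only [quadForm_add_right hP.isSymm, quadForm_smul_right, mulVec_smul, dotProduct_smul,
    smul_dotProduct, smul_eq_mul] at h1 h2
  have hpos : 0 < quadForm P x + quadForm P y := by
    rcases eq_or_ne x 0 with hx0 | hx0
    · have hy0 : y ≠ 0 := by
        intro hy0
        apply hv0
        ext i
        exact Complex.ext (congrFun hx0 i) (congrFun hy0 i)
      linarith [hP.quadForm_pos hy0, hP.quadForm_nonneg x]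
    · linarith [hP.quadForm_pos hx0, hP.quadForm_nonneg y]
  have h3 : (z.re ^ 2 + z.im ^ 2) * (quadForm P x + quadForm P y) ≤
      1 * (quadForm P x + quadForm P y) := by nlinarith
  have h4 := le_of_mul_le_mul_right h3 hpos
  have h5 : ‖z‖ ^ 2 = z.re ^ 2 + z.im ^ 2 := by rw [Complex.sq_norm, Complex.normSq_apply]; ring
  nlinarith [norm_nonneg z]

/-- Every linear factor satisfies |z - a| ≥ |z| - 1. The bound depends only on the degree, so it
survives limits and replaces continuity of roots. -/
lemma Polynomial.pow_le_norm_eval_of_roots {p : Polynomial ℂ} (hp : p.Monic)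
    (hroots : ∀ z ∈ p.roots, ‖z‖ ≤ 1) {z : ℂ} (hz : 1 ≤ ‖z‖) :
    (‖z‖ - 1) ^ p.natDegree ≤ ‖p.eval z‖ := by
  have key : ∀ s : Multiset ℂ, (∀ w ∈ s, ‖w‖ ≤ 1) →
      (‖z‖ - 1) ^ s.card ≤ ‖((s.map fun a => Polynomial.X - Polynomial.C a).prod).eval z‖ := by
    intro s
    induction s using Multiset.induction_on with
    | empty => simp
    | cons a s ih =>
      intro hs
      have h1 := ih fun w hw => hs w (Multiset.mem_cons_of_mem hw)
      have h2 : ‖z‖ - 1 ≤ ‖z - a‖ := by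
        linarith [norm_sub_norm_le z a, hs a (Multiset.mem_cons_self _ _)]
      simp only [Multiset.card_cons, Multiset.map_cons, Multiset.prod_cons, Polynomial.eval_mul,
        norm_mul, Polynomial.eval_sub, Polynomial.eval_X, Polynomial.eval_C]
      rw [pow_succ']
      exact mul_le_mul h2 h1 (pow_nonneg (by linarith) _) (norm_nonneg _)
  have hs := IsAlgClosed.splits p
  have h := key p.roots hroots
  rw [← hs.natDegree_eq_card_roots] at h
  have e := hs.eq_prod_roots
  rw [hp.leadingCoeff, Polynomial.C_1, one_mul] at e
  rwa [← e] at h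

/-- The matrix determinant lemma without invertibility, in the complex case. -/
lemma det_add_vecMulVec (M : Matrix (Fin n) (Fin n) ℂ) (u v : Fin n → ℂ) :
    (M + vecMulVec u v).det = M.det + v ⬝ᵥ adjugate M *ᵥ u := by
  have hreg : ∀ N : Matrix (Fin n) (Fin n) ℂ, N.det ≠ 0 →
      (N + vecMulVec u v).det = N.det + v ⬝ᵥ adjugate N *ᵥ u := by
    intro N hN
    have hu : IsUnit N.det := isUnit_iff_ne_zero.2 hN
    have e : vecMulVec u v = replicateCol (Fin 1) u * replicateRow (Fin 1) v := by
      ext i j; simp [vecMulVec_apply, Matrix.mul_apply]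
    have h00 : (replicateRow (Fin 1) v * N⁻¹ * replicateCol (Fin 1) u :
        Matrix (Fin 1) (Fin 1) ℂ) 0 0 = v ⬝ᵥ N⁻¹ *ᵥ u := by
      rw [Matrix.mul_assoc]; rfl
    rw [e, det_add_mul _ _ hu, Matrix.det_fin_one, Matrix.add_apply, Matrix.one_apply_eq, h00,
      mul_add, mul_one, Matrix.inv_def, smul_mulVec, dotProduct_smul, smul_eq_mul, ← mul_assoc,
      Ring.mul_inverse_cancel _ hu, one_mul]
  -- Singular M is reached as a limit of M + t I, which is invertible for small t ≠ 0.
  have hc : Continuous fun t : ℂ => M + t • (1 : Matrix (Fin n) (Fin n) ℂ) := by fun_prop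
  have h1 : Continuous fun t : ℂ => (M + t • (1 : Matrix (Fin n) (Fin n) ℂ) + vecMulVec u v).det :=
    (hc.add continuous_const).matrix_det
  have h2 : Continuous fun t : ℂ => (M + t • (1 : Matrix (Fin n) (Fin n) ℂ)).det +
      v ⬝ᵥ adjugate (M + t • (1 : Matrix (Fin n) (Fin n) ℂ)) *ᵥ u :=
    hc.matrix_det.add (continuous_const.dotProduct
      (hc.matrix_adjugate.matrix_mulVec continuous_const))
  have hdet : ∀ t : ℂ, (M + t • (1 : Matrix (Fin n) (Fin n) ℂ)).det = (-M).charpoly.eval t := by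
    intro t
    rw [eval_charpoly, sub_neg_eq_add, add_comm, Matrix.scalar_apply, smul_one_eq_diagonal]
  have hev : ∀ᶠ t in 𝓝[≠] (0 : ℂ), (M + t • (1 : Matrix (Fin n) (Fin n) ℂ)).det ≠ 0 := by
    have hfin : {t : ℂ | (-M).charpoly.IsRoot t}.Finite :=
      Polynomial.finite_setOfPred_isRoot (charpoly_monic _).ne_zero
    have h3 : ({t : ℂ | (-M).charpoly.IsRoot t} \ {0})ᶜ ∈ 𝓝 (0 : ℂ) :=
      (hfin.subset Set.sdiff_subset).isClosed.isOpen_compl.mem_nhds (by simp)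
    filter_upwards [mem_nhdsWithin_of_mem_nhds h3, self_mem_nhdsWithin] with t ht ht0
    rw [hdet]
    intro h
    exact ht ⟨h, ht0⟩
  have h3 := (h1.tendsto 0).mono_left (nhdsWithin_le_nhds (s := {0}ᶜ))
  have h4 := (h2.tendsto 0).mono_left (nhdsWithin_le_nhds (s := {0}ᶜ))
  have h5 := tendsto_nhds_unique (h3.congr' (hev.mono fun t ht => hreg _ ht)) h4
  simpa using h5

/-- The return difference identity on the unit circle. -/
lemma norm_eval_charpoly_closedLoop {P : Matrix (Fin n) (Fin n) ℝ} (hP : P.IsSymm)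
    (hP0 : ∀ x, 0 ≤ quadForm P x) (hfix : riccatiMap A b 1 1 0 P = P) {z : ℂ} (hz : ‖z‖ = 1) :
    (1 + quadForm P b) *
        ‖((closedLoop A b P).map (fun r : ℝ => (r : ℂ))).charpoly.eval z‖ ^ 2 =
      ‖(A.map (fun r : ℝ => (r : ℂ))).charpoly.eval z‖ ^ 2 := by
  have hg : 0 < 1 + quadForm P b := by linarith [hP0 b]
  rw [eval_charpoly, eval_charpoly]
  set M : Matrix (Fin n) (Fin n) ℂ := scalar (Fin n) z - A.map (fun r : ℝ => (r : ℂ)) with hM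
  let q : Fin n → ℝ := Aᵀ *ᵥ P *ᵥ b
  have e1 : scalar (Fin n) z - (closedLoop A b P).map (fun r : ℝ => (r : ℂ)) =
      M + vecMulVec (fun i => (b i : ℂ)) (fun i => ((1 / (1 + quadForm P b) * q i : ℝ) : ℂ)) := by
    ext i j
    simp [hM, closedLoop, vecMulVec_apply, q]
    ring
  rw [e1, det_add_vecMulVec]
  -- With the adjugate, M v = det(M) b holds even for singular M, so z may be an eigenvalue of A.
  -- The Riccati equation is evaluated at the real and imaginary parts of v.
  set v : Fin n → ℂ := adjugate M *ᵥ fun i => (b i : ℂ) with hv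
  set a : ℂ := M.det
  have hMv : M *ᵥ v = a • fun i => (b i : ℂ) := by
    rw [hv, mulVec_mulVec, mul_adjugate, smul_mulVec, one_mulVec]
  have hAv : ∀ i, ∑ j, (A i j : ℂ) * v j = z * v i - a * b i := by
    intro i
    have := congrFun hMv i
    simp only [hM, sub_mulVec, Pi.sub_apply, Pi.smul_apply, smul_eq_mul] at this
    have e2 : (scalar (Fin n) z *ᵥ v) i = z * v i := by
      simp [mulVec, dotProduct, Matrix.scalar_apply, diagonal_apply]
    rw [e2] at this
    have e3 : ((A.map (fun r : ℝ => (r : ℂ))) *ᵥ v) i = ∑ j, (A i j : ℂ) * v j := rfl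
    rw [← this, e3]; ring
  let x : Fin n → ℝ := fun i => (v i).re
  let y : Fin n → ℝ := fun i => (v i).im
  have hx : A *ᵥ x = z.re • x + (-z.im) • y + (-a.re) • b := by
    ext i
    have := congrArg Complex.re (hAv i)
    simp only [Complex.re_sum, Complex.mul_re, Complex.ofReal_re, Complex.ofReal_im, zero_mul,
      mul_zero, sub_zero, Complex.sub_re] at this
    simp only [mulVec, dotProduct, x, y, Pi.add_apply, Pi.smul_apply, smul_eq_mul]
    linarith
  have hy : A *ᵥ y = z.im • x + z.re • y + (-a.im) • b := by
    ext i
    have := congrArg Complex.im (hAv i)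
    simp only [Complex.im_sum, Complex.mul_im, Complex.ofReal_re, Complex.ofReal_im, zero_mul,
      mul_zero, add_zero, zero_add, Complex.sub_im] at this
    simp only [mulVec, dotProduct, x, y, Pi.add_apply, Pi.smul_apply, smul_eq_mul]
    linarith
  have hrx := quadForm_riccatiMap (A := A) (b := b) (ρ := 1) (γ := 1) hP 0 x
  have hry := quadForm_riccatiMap (A := A) (b := b) (ρ := 1) (γ := 1) hP 0 y
  have hbx : b ⬝ᵥ P *ᵥ A *ᵥ x = z.re * (b ⬝ᵥ P *ᵥ x) - z.im * (b ⬝ᵥ P *ᵥ y) -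
      a.re * quadForm P b := by
    rw [hx]; simp only [mulVec_add, dotProduct_add, mulVec_smul, dotProduct_smul, smul_eq_mul,
      quadForm]; ring
  have hby : b ⬝ᵥ P *ᵥ A *ᵥ y = z.im * (b ⬝ᵥ P *ᵥ x) + z.re * (b ⬝ᵥ P *ᵥ y) -
      a.im * quadForm P b := by
    rw [hy]; simp only [mulVec_add, dotProduct_add, mulVec_smul, dotProduct_smul, smul_eq_mul,
      quadForm]; ring
  rw [hfix, hbx, hx, quadForm_zero_left] at hrx
  rw [hfix, hby, hy, quadForm_zero_left] at hry
  simp only [quadForm_add_right hP, quadForm_smul_right, mulVec_smul, dotProduct_smul,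
    smul_dotProduct, smul_eq_mul, add_dotProduct, dotProduct_mulVec_symm hP x b,
    dotProduct_mulVec_symm hP y b] at hrx hry
  have hκ : (fun i => ((1 / (1 + quadForm P b) * q i : ℝ) : ℂ)) ⬝ᵥ v =
      ⟨1 / (1 + quadForm P b) * (b ⬝ᵥ P *ᵥ A *ᵥ x), 1 / (1 + quadForm P b) *
        (b ⬝ᵥ P *ᵥ A *ᵥ y)⟩ := by
    rw [← transpose_mulVec_mulVec_dotProduct hP, ← transpose_mulVec_mulVec_dotProduct hP]
    apply Complex.ext
    · simp only [dotProduct, Complex.re_sum, Complex.mul_re, Complex.ofReal_re, Complex.ofReal_im,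
        zero_mul, sub_zero, Finset.mul_sum, x, q, mul_assoc]
    · simp only [dotProduct, Complex.im_sum, Complex.mul_im, Complex.ofReal_re, Complex.ofReal_im,
        zero_mul, add_zero, Finset.mul_sum, y, q, mul_assoc]
  have hz2 : z.re ^ 2 + z.im ^ 2 = 1 := by
    have : ‖z‖ ^ 2 = z.re ^ 2 + z.im ^ 2 := by rw [Complex.sq_norm, Complex.normSq_apply]; ring
    rw [← this, hz, one_pow]
  rw [hκ, hbx, hby, Complex.sq_norm, Complex.sq_norm, Complex.normSq_apply, Complex.normSq_apply,
    Complex.add_re, Complex.add_im]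
  generalize b ⬝ᵥ P *ᵥ x = X at *
  generalize b ⬝ᵥ P *ᵥ y = Y at *
  generalize x ⬝ᵥ P *ᵥ y = W at *
  generalize quadForm P x = px at *
  generalize quadForm P y = py at *
  generalize quadForm P b = g at *
  generalize a.re = α at *
  generalize a.im = β at *
  generalize z.re = c at *
  generalize z.im = s at *
  have hr : (1 + g) * (1 / (1 + g)) = 1 := by field_simp
  generalize 1 / (1 + g) = r at *
  -- Adding the two Riccati identities, the terms in `px` and `py` cancel because |z| = 1.
  have hsum : r * ((c * X - s * Y - α * g) ^ 2 + (s * X + c * Y - β * g) ^ 2) =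
      -(α ^ 2 + β ^ 2) * g - 2 * α * (c * X - s * Y - α * g) -
        2 * β * (s * X + c * Y - β * g) := by
    linear_combination hrx + hry + (px + py) * hz2
  generalize c * X - s * Y - α * g = D₁ at *
  generalize s * X + c * Y - β * g = D₂ at *
  linear_combination hsum + (2 * (α * D₁ + β * D₂) + r * (D₁ ^ 2 + D₂ ^ 2)) * hr

end ClosedLoop

/-! ### The Mahler measure threshold and the modified Riccati equation. -/

section ModifiedRiccati

variable {n : ℕ} {A : Matrix (Fin n) (Fin n) ℝ} {b : Fin n → ℝ}

lemma one_add_quadForm_eq_matrixMahler_sq {P : Matrix (Fin n) (Fin n) ℝ} (hP : P.IsSymm)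
    (hP0 : ∀ x, 0 ≤ quadForm P x) (hfix : riccatiMap A b 1 1 0 P = P)
    (hroots : ∀ z ∈ ((closedLoop A b P).map (fun r : ℝ => (r : ℂ))).charpoly.roots, ‖z‖ ≤ 1) :
    1 + quadForm P b = matrixMahler A ^ 2 := by
  set c := ((closedLoop A b P).map (fun r : ℝ => (r : ℂ))).charpoly with hc
  set a := (A.map (fun r : ℝ => (r : ℂ))).charpoly with ha
  have hg : 0 < 1 + quadForm P b := by linarith [hP0 b]
  have hcm : c.Monic := charpoly_monic _
  have ham : a.Monic := charpoly_monic _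
  have hMa : a.mahlerMeasure = matrixMahler A := by
    rw [Polynomial.mahlerMeasure_eq_leadingCoeff_mul_prod_roots, ham.leadingCoeff, norm_one,
      one_mul]
    rfl
  have hMc : c.mahlerMeasure = 1 := by
    rw [Polynomial.mahlerMeasure_eq_leadingCoeff_mul_prod_roots, hcm.leadingCoeff, norm_one,
      one_mul]
    refine Multiset.prod_eq_one fun r hr => ?_
    obtain ⟨z, hz, rfl⟩ := Multiset.mem_map.1 hr
    exact max_eq_left (hroots z hz)
  have hs : (Real.sqrt (1 + quadForm P b) : ℂ) ≠ 0 := by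
    exact_mod_cast (Real.sqrt_pos.2 hg).ne'
  have hcs : Polynomial.C (Real.sqrt (1 + quadForm P b) : ℂ) * c ≠ 0 :=
    mul_ne_zero (Polynomial.C_ne_zero.2 hs) hcm.ne_zero
  -- The Mahler measure sees a polynomial only through its modulus on the unit circle.
  have hM : (Polynomial.C (Real.sqrt (1 + quadForm P b) : ℂ) * c).mahlerMeasure =
      a.mahlerMeasure := by
    have h2 : ∀ z : ℂ, ‖z‖ = 1 →
        ‖(Polynomial.C (Real.sqrt (1 + quadForm P b) : ℂ) * c).eval z‖ = ‖a.eval z‖ := by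
      intro z hz
      rw [Polynomial.eval_mul, Polynomial.eval_C, norm_mul, Complex.norm_real,
        Real.norm_of_nonneg (Real.sqrt_nonneg _)]
      refine (pow_left_inj₀ (by positivity) (by positivity) two_ne_zero).1 ?_
      rw [mul_pow, Real.sq_sqrt hg.le, norm_eval_charpoly_closedLoop hP hP0 hfix hz]
    rw [Polynomial.mahlerMeasure_def_of_ne_zero hcs,
      Polynomial.mahlerMeasure_def_of_ne_zero ham.ne_zero]
    simp only [h2 (circleMap 0 1 _) (by simp)]
  rw [Polynomial.mahlerMeasure_mul, Polynomial.mahlerMeasure_const, hMc, mul_one, hMa,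
    Complex.norm_real, Real.norm_of_nonneg (Real.sqrt_nonneg _)] at hM
  rw [← hM, Real.sq_sqrt hg.le]

lemma riccatiMap_eq_add (ρ γ : ℝ) (Q P : Matrix (Fin n) (Fin n) ℝ) :
    riccatiMap A b ρ γ Q P = riccatiMap A b ρ γ 0 P + Q := by
  simp [riccatiMap]

/-- For a small state weight, the optimal cost of the input direction in the linear quadratic
regulator problem is close to the squared Mahler measure. -/
lemma exists_regulator_lt {κ : Fin n → ℝ}
    (hF : ∀ z ∈ spectrum ℂ ((A + vecMulVec b κ).map (fun r : ℝ => (r : ℂ))), ‖z‖ < 1)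
    {d : ℝ} (hd : matrixMahler A ^ 2 < d) :
    ∃ ε : ℝ, 0 < ε ∧ ∃ P : Matrix (Fin n) (Fin n) ℝ, P.PosDef ∧
      riccatiMap A b 1 1 (ε • 1) P = P ∧ 1 + quadForm P b < d := by
  have hQ : ∀ k : ℕ, ((1 / ((k : ℝ) + 1)) • (1 : Matrix (Fin n) (Fin n) ℝ)).PosDef := fun k =>
    Matrix.PosDef.one.smul (by positivity)
  have hex := fun k : ℕ => exists_least_riccatiMap_fixedPoint (A := A) (b := b) zero_le_one
    zero_le_one le_rfl (hQ k) (exists_riccatiMap_le_of_schur hF _)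
  choose p hpd hfix hleast using hex
  have hanti : ∀ x, Antitone fun k => quadForm (p k) x := by
    intro x
    refine antitone_nat_of_succ_le fun k => ?_
    -- A fixed point for a larger state weight is a supersolution for a smaller one.
    refine hleast (k + 1) (p k) (hpd k).isSymm (hpd k).quadForm_nonneg (fun y => ?_) x
    conv_rhs => rw [← hfix k]
    rw [riccatiMap_eq_add, riccatiMap_eq_add _ _ (_ • 1) (p k), quadForm_add_left,
      quadForm_add_left, quadForm_smul_left, quadForm_smul_left]
    have h1 : 1 / (((k + 1 : ℕ) : ℝ) + 1) ≤ 1 / ((k : ℝ) + 1) := by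
      apply one_div_le_one_div_of_le (by positivity); push_cast; linarith
    have h2 := Matrix.PosDef.one (n := Fin n) (R := ℝ) |>.quadForm_nonneg y
    have := mul_le_mul_of_nonneg_right h1 h2
    linarith
  obtain ⟨L, hL, hlim⟩ := exists_tendsto_of_monotone_quadForm (P := fun k => -p k)
    (fun k => (hpd k).isSymm.neg)
    (fun x j k hjk => by simp only [quadForm_neg_left]; exact neg_le_neg (hanti x hjk))
    (fun x => ⟨0, by
      rintro _ ⟨k, rfl⟩
      simp only [quadForm_neg_left]
      exact neg_nonpos.2 ((hpd k).quadForm_nonneg x)⟩)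
  have hlim' : Tendsto p atTop (𝓝 (-L)) := by simpa using hlim.neg
  have hq : ∀ x, Tendsto (fun k => quadForm (p k) x) atTop (𝓝 (quadForm (-L) x)) := fun x =>
    ((continuous_quadForm_left x).tendsto (-L)).comp hlim'
  have hS : (-L).IsSymm := hL.neg
  have hnn : ∀ x, 0 ≤ quadForm (-L) x := fun x =>
    ge_of_tendsto' (hq x) fun k => (hpd k).quadForm_nonneg x
  generalize -L = S at *
  have hSb : 0 < 1 + quadForm S b := by linarith [hnn b]
  have hSfix : riccatiMap A b 1 1 0 S = S := by
    have h1 : Tendsto (fun k => riccatiMap A b 1 1 0 (p k)) atTop (𝓝 (riccatiMap A b 1 1 0 S)) :=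
      (continuousAt_riccatiMap (A := A) (b := b) (γ := 1) 0 (Or.inl hSb.ne')).tendsto.comp hlim'
    have h2 : Tendsto (fun k : ℕ => (1 / ((k : ℝ) + 1)) • (1 : Matrix (Fin n) (Fin n) ℝ)) atTop
        (𝓝 ((0 : ℝ) • 1)) := tendsto_one_div_add_atTop_nhds_zero_nat.smul_const _
    rw [zero_smul] at h2
    have h3 := h1.add h2
    simp only [← riccatiMap_eq_add, hfix, add_zero] at h3
    exact tendsto_nhds_unique h3 hlim'
  have hcl : Tendsto (fun k => closedLoop A b (p k)) atTop (𝓝 (closedLoop A b S)) := by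
    have h1 : Tendsto (fun k => 1 / (1 + quadForm (p k) b)) atTop (𝓝 (1 / (1 + quadForm S b))) :=
      tendsto_const_nhds.div ((hq b).const_add 1) hSb.ne'
    have h2 : Continuous fun P : Matrix (Fin n) (Fin n) ℝ => vecMulVec b (Aᵀ *ᵥ P *ᵥ b) :=
      continuous_const.matrix_vecMulVec (by fun_prop)
    exact (h1.smul ((h2.tendsto S).comp hlim')).const_sub A
  -- The characteristic polynomials along the sequence are at least (|z| - 1)^n in modulus at any
  -- |z| > 1, so the limit cannot vanish there.
  have hroots : ∀ z ∈ ((closedLoop A b S).map (fun r : ℝ => (r : ℂ))).charpoly.roots,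
      ‖z‖ ≤ 1 := by
    intro z hz
    by_contra! hz1
    have hev : ∀ F : Matrix (Fin n) (Fin n) ℝ, (F.map (fun r : ℝ => (r : ℂ))).charpoly.eval z =
        (scalar (Fin n) z - F.map (fun r : ℝ => (r : ℂ))).det := fun F => eval_charpoly _ _
    have hcont : Continuous fun F : Matrix (Fin n) (Fin n) ℝ =>
        ‖(F.map (fun r : ℝ => (r : ℂ))).charpoly.eval z‖ := by
      simp only [hev]
      exact (continuous_const.sub (continuous_id.matrix_map
        Complex.continuous_ofReal)).matrix_det.norm
    have h1 := ge_of_tendsto' ((hcont.tendsto _).comp hcl) (b := (‖z‖ - 1) ^ n) fun k => by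
      have h2 := Polynomial.pow_le_norm_eval_of_roots
        (charpoly_monic ((closedLoop A b (p k)).map (fun r : ℝ => (r : ℂ))))
        (fun w hw => norm_le_one_of_isRoot_charpoly (hpd k)
          (quadForm_closedLoop_le (hpd k).isSymm (hpd k).quadForm_nonneg (hQ k).quadForm_nonneg
            (hfix k)) (Polynomial.isRoot_of_mem_roots hw)) hz1.le
      rwa [charpoly_natDegree_eq_dim, Fintype.card_fin] at h2
    have h3 : ((closedLoop A b S).map (fun r : ℝ => (r : ℂ))).charpoly.eval z = 0 :=
      Polynomial.isRoot_of_mem_roots hz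
    have h4 : 0 < (‖z‖ - 1) ^ n := pow_pos (by linarith) n
    simp only [h3, norm_zero] at h1
    linarith
  have hM := one_add_quadForm_eq_matrixMahler_sq hS hnn hSfix hroots
  rw [← hM] at hd
  obtain ⟨k, hk⟩ := (((hq b).const_add 1).eventually_lt_const hd).exists
  exact ⟨1 / ((k : ℝ) + 1), by positivity, p k, hpd k, hfix k, hk⟩

lemma one_le_matrixMahler (A : Matrix (Fin n) (Fin n) ℝ) : 1 ≤ matrixMahler A :=
  Polynomial.one_le_prod_max_one_norm_roots _

/-- The modified Riccati inequality is solvable below the critical correction factor. -/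
lemma exists_modified_riccatiMap_le {κ : Fin n → ℝ}
    (hF : ∀ z ∈ spectrum ℂ ((A + vecMulVec b κ).map (fun r : ℝ => (r : ℂ))), ‖z‖ < 1)
    {e : ℝ} (he0 : 0 ≤ e) (he : e < 1 / matrixMahler A ^ 2) (Q : Matrix (Fin n) (Fin n) ℝ) :
    ∃ S : Matrix (Fin n) (Fin n) ℝ, S.IsSymm ∧ (∀ x, 0 ≤ quadForm S x) ∧
      ∀ x, quadForm (riccatiMap A b 0 (1 - e) Q S) x ≤ quadForm S x := by
  have hM : 0 < matrixMahler A ^ 2 := pow_pos (zero_lt_one.trans_le (one_le_matrixMahler A)) 2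
  -- Take d = 1/e; for e = 0 any d above M(A)² works.
  obtain ⟨d, hd1, hd2⟩ : ∃ d, matrixMahler A ^ 2 < d ∧ e * d ≤ 1 := by
    rcases he0.eq_or_lt with rfl | h
    · exact ⟨matrixMahler A ^ 2 + 1, by linarith, by simp⟩
    · refine ⟨1 / e, ?_, by rw [mul_one_div_cancel h.ne']⟩
      rw [lt_one_div hM h]; exact he
  obtain ⟨ε, hε, P, hP, hfix, hg⟩ := exists_regulator_lt hF hd1
  obtain ⟨C, hC, hCQ⟩ := (Matrix.PosDef.one (n := Fin n) (R := ℝ)).exists_quadForm_le Q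
  have hle : ∀ x, quadForm (riccatiMap A b 0 (1 - e) 0 P) x ≤
      quadForm P x - ε * quadForm 1 x := by
    intro x
    have h1 := quadForm_riccatiMap (A := A) (b := b) (ρ := 1) (γ := 1) hP.isSymm (ε • 1) x
    rw [hfix, quadForm_smul_left] at h1
    rw [quadForm_riccatiMap hP.isSymm, h1, quadForm_zero_left, zero_add]
    -- For g > 0 this is equivalent to e (1 + g) ≤ 1, which follows from 1 + g < d and e d ≤ 1.
    have h2 : 1 / (1 + quadForm P b) * (b ⬝ᵥ P *ᵥ A *ᵥ x) ^ 2 ≤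
        (1 - e) / quadForm P b * (b ⬝ᵥ P *ᵥ A *ᵥ x) ^ 2 := by
      rcases (hP.quadForm_nonneg b).eq_or_lt with h0 | h0
      · rw [dotProduct_eq_zero_of_quadForm_eq_zero hP.isSymm hP.quadForm_nonneg h0.symm]
        simp
      · refine mul_le_mul_of_nonneg_right ?_ (sq_nonneg _)
        rw [div_le_div_iff₀ (by linarith) h0]
        nlinarith [mul_le_mul_of_nonneg_left hg.le he0]
    linarith
  refine ⟨(C / ε) • P, hP.isSymm.smul _, fun x => ?_, fun x => ?_⟩
  · rw [quadForm_smul_left]; exact mul_nonneg (by positivity) (hP.quadForm_nonneg x)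
  · rw [quadForm_riccatiMap_smul hP.isSymm, quadForm_smul_left]
    have h1 := mul_le_mul_of_nonneg_left (hle x) (show 0 ≤ C / ε by positivity)
    have h2 : C / ε * (quadForm P x - ε * quadForm 1 x) =
        C / ε * quadForm P x - C * quadForm 1 x := by field_simp
    linarith [hCQ x]

/-- Inversion of a 1 × 1 matrix; when bᵀPb = 0 both sides are 0, matching the convention for B = 0.
-/
lemma inv_transpose_mul_mul_col (B : Matrix (Fin n) (Fin 1) ℝ) (P : Matrix (Fin n) (Fin n) ℝ) :
    (Bᵀ * P * B)⁻¹ = diagonal fun _ => (quadForm P (B.col 0))⁻¹ := by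
  have hg : (Bᵀ * P * B) 0 0 = quadForm P (B.col 0) := by
    rw [Matrix.mul_assoc]; rfl
  rw [Matrix.inv_subsingleton]
  congr 1
  ext i
  rw [Subsingleton.elim i 0, hg, Ring.inverse_eq_inv']

/-- The modified Riccati map in the matrix notation of the equation. -/
lemma riccatiMap_col_eq (B : Matrix (Fin n) (Fin 1) ℝ) (δ : ℝ) (Q : Matrix (Fin n) (Fin n) ℝ)
    {P : Matrix (Fin n) (Fin n) ℝ} (hP : P.IsSymm) :
    riccatiMap A (B.col 0) 0 (1 - δ ^ 2) Q P =
      Aᵀ * P * A - (1 - δ ^ 2) • (Aᵀ * P * B * (Bᵀ * P * B)⁻¹ * Bᵀ * P * A) + Q := by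
  have hX : ∀ i, (Aᵀ * P * B) i 0 = (Aᵀ *ᵥ P *ᵥ B.col 0) i := by
    intro i
    rw [mulVec_mulVec]; rfl
  have hT : Bᵀ * P * A = (Aᵀ * P * B)ᵀ := by
    simp [hP.eq, Matrix.mul_assoc]
  rw [Matrix.mul_assoc _ Bᵀ P, Matrix.mul_assoc _ (Bᵀ * P) A, hT, inv_transpose_mul_mul_col,
    riccatiMap, zero_add]
  congr 2
  ext i j
  simp only [Matrix.smul_apply, vecMulVec_apply, ← hX, smul_eq_mul, Matrix.mul_apply (N := _ᵀ),
    Fin.sum_univ_one, Matrix.mul_diagonal, transpose_apply]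
  ring

theorem existsUnique_isMARESolution {B : Matrix (Fin n) (Fin 1) ℝ} (hAB : Stabilizable A B)
    {δ : ℝ} (hδ : δ ^ 2 < 1 / matrixMahler A ^ 2) {Q : Matrix (Fin n) (Fin n) ℝ} (hQ : Q.PosDef) :
    ∃! P : Matrix (Fin n) (Fin n) ℝ, IsMARESolution A B δ Q P := by
  have hδ1 : δ ^ 2 ≤ 1 := by
    refine hδ.le.trans ?_
    rw [div_le_one (pow_pos (zero_lt_one.trans_le (one_le_matrixMahler A)) 2)]
    exact one_le_pow₀ (one_le_matrixMahler A)
  obtain ⟨K, hK⟩ := hAB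
  have hBK : B * K = vecMulVec (B.col 0) (K.row 0) := by
    ext i j; simp [Matrix.mul_apply, vecMulVec_apply]
  rw [hBK] at hK
  obtain ⟨P, hP, hfix, -⟩ := exists_least_riccatiMap_fixedPoint (A := A) (b := B.col 0) le_rfl
    (sub_nonneg.2 hδ1) (sub_le_self _ (sq_nonneg δ)) hQ
    (exists_modified_riccatiMap_le hK (sq_nonneg δ) hδ Q)
  refine ⟨P, ⟨hP, ?_⟩, ?_⟩
  · rw [← riccatiMap_col_eq B δ Q hP.isSymm, hfix]
  · rintro P' ⟨hP', hfix'⟩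
    rw [← riccatiMap_col_eq B δ Q hP'.isSymm] at hfix'
    refine hP'.isSymm.eq_of_quadForm hP.isSymm fun x => le_antisymm ?_ ?_
    · exact riccatiMap_fixedPoint_le (sub_nonneg.2 hδ1) (sub_le_self _ (sq_nonneg δ)) hQ hP' hP
        hfix'.symm hfix x
    · exact riccatiMap_fixedPoint_le (sub_nonneg.2 hδ1) (sub_le_self _ (sq_nonneg δ)) hQ hP hP'
        hfix hfix'.symm x

end ModifiedRiccati

/-! ### Laplacian modes and the consensus condition. -/

section Laplacian

/-- A convex quadratic in l lies below its chord. -/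
lemma consensusBound_le_of_mem_Icc {α ϱsq d l₁ l₂ l : ℝ} (hϱ : 0 ≤ ϱsq)
    (h1 : consensusBound α ϱsq l₁ ≤ d) (h2 : consensusBound α ϱsq l₂ ≤ d) (hl1 : l₁ ≤ l)
    (hl2 : l ≤ l₂) : consensusBound α ϱsq l ≤ d := by
  rcases hl1.eq_or_lt with rfl | hlt
  · exact h1
  unfold consensusBound at *
  have h12 : 0 < l₂ - l₁ := by linarith
  have key : (l₂ - l₁) * ((α * l - 1) ^ 2 + α ^ 2 * ϱsq * l ^ 2) ≤ (l₂ - l₁) * d := by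
    have e1 := mul_le_mul_of_nonneg_left h1 (sub_nonneg.2 hl2)
    have e2 := mul_le_mul_of_nonneg_left h2 (sub_nonneg.2 hl1)
    have e3 : 0 ≤ α ^ 2 * (1 + ϱsq) * ((l₂ - l₁) * (l₂ - l) * (l - l₁)) := by
      have : 0 ≤ (l₂ - l₁) * (l₂ - l) * (l - l₁) :=
        mul_nonneg (mul_nonneg h12.le (sub_nonneg.2 hl2)) (sub_nonneg.2 hl1)
      positivity
    linarith
  exact le_of_mul_le_mul_left key h12

variable {N : ℕ} (G : SimpleGraph (Fin N)) [DecidableRel G.Adj]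

lemma dotProduct_eq_sum_eigenvectorBasis {M : Matrix (Fin N) (Fin N) ℝ} (hM : M.IsHermitian)
    (x y : Fin N → ℝ) :
    x ⬝ᵥ y = ∑ m, ((hM.eigenvectorBasis m).ofLp ⬝ᵥ x) * ((hM.eigenvectorBasis m).ofLp ⬝ᵥ y) := by
  have h := hM.eigenvectorBasis.sum_inner_mul_inner (WithLp.toLp 2 x) (WithLp.toLp 2 y)
  simp only [EuclideanSpace.inner_eq_star_dotProduct, star_trivial] at h
  rw [dotProduct_comm, ← h]
  exact Finset.sum_congr rfl fun m _ => by rw [dotProduct_comm y]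

lemma eigenvectorBasis_dotProduct_mulVec {M : Matrix (Fin N) (Fin N) ℝ} (hM : M.IsHermitian)
    (m : Fin N) (x : Fin N → ℝ) :
    (hM.eigenvectorBasis m).ofLp ⬝ᵥ M *ᵥ x =
      hM.eigenvalues m * ((hM.eigenvectorBasis m).ofLp ⬝ᵥ x) := by
  have hs : Mᵀ = M := by simpa [Matrix.IsHermitian] using hM
  rw [dotProduct_mulVec, ← mulVec_transpose, hs, hM.mulVec_eigenvectorBasis, smul_dotProduct,
    smul_eq_mul]

/-- The decrease of the disagreement under the Laplacian in the input channel. -/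
theorem lapMatrix_disagreement_le (hN : 1 < N) (hN1 : N - 1 < N) (hG : G.Connected)
    {α ϱsq d : ℝ} (hϱ : 0 ≤ ϱsq)
    (h2 : consensusBound α ϱsq (lapEigenvalue G ⟨1, hN⟩) ≤ d)
    (h3 : consensusBound α ϱsq (lapEigenvalue G ⟨N - 1, hN1⟩) ≤ d) (s : Fin N → ℝ) :
    -2 * α * (s ⬝ᵥ G.lapMatrix ℝ *ᵥ s) +
        α ^ 2 * (1 + ϱsq) * ((G.lapMatrix ℝ *ᵥ s) ⬝ᵥ (G.lapMatrix ℝ *ᵥ s)) ≤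
      -(1 - d) * (s ⬝ᵥ s - (∑ i, s i) ^ 2 / N) := by
  have hH := G.isHermitian_lapMatrix ℝ
  let e : Fin (Fintype.card (Fin N)) ≃ Fin N := Fintype.equivOfCardEq (Fintype.card_fin _)
  have hev : ∀ k, hH.eigenvalues (e k) = hH.eigenvalues₀ k := fun k => by
    simp [Matrix.IsHermitian.eigenvalues, e]
  have hcard : Fintype.card (Fin N) = N := Fintype.card_fin N
  let last : Fin (Fintype.card (Fin N)) := ⟨N - 1, by omega⟩
  have hnn : ∀ m, 0 ≤ hH.eigenvalues m := fun m => (G.posSemidef_lapMatrix ℝ).eigenvalues_nonneg m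
  -- `eigenvalues₀` is nonincreasing, so the last index carries the smallest eigenvalue, which is 0
  -- since the Laplacian is singular and positive semidefinite.
  have hzero : hH.eigenvalues (e last) = 0 := by
    refine le_antisymm ?_ (hnn _)
    have : Nonempty (Fin N) := ⟨⟨0, by omega⟩⟩
    have hdet : (G.lapMatrix ℝ).det = 0 := G.det_lapMatrix_eq_zero
    rw [hH.det_eq_prod_eigenvalues] at hdet
    obtain ⟨m, -, hm⟩ := Finset.prod_eq_zero_iff.1 hdet
    have hm' : hH.eigenvalues m = 0 := by simpa using hm
    rw [← hm', hev, ← e.apply_symm_apply m, hev]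
    refine hH.eigenvalues₀_antitone ?_
    rw [Fin.le_def]
    have := (e.symm m).2
    simp only [last]
    omega
  -- By connectedness the unit kernel vector is constant, so its mode is the average.
  have hconst : ((hH.eigenvectorBasis (e last)).ofLp ⬝ᵥ s) ^ 2 = (∑ i, s i) ^ 2 / N := by
    set v := (hH.eigenvectorBasis (e last)).ofLp with hv
    have hLv : G.lapMatrix ℝ *ᵥ v = 0 := by
      rw [hv, hH.mulVec_eigenvectorBasis, hzero, zero_smul]
    have hc : ∀ i j, v i = v j := fun i j =>
      (G.lapMatrix_mulVec_eq_zero_iff_forall_reachable.1 hLv) i j (hG.preconnected i j)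
    let i₀ : Fin N := ⟨0, by omega⟩
    have hv' : v = fun _ => v i₀ := funext fun i => hc i i₀
    have hnorm : v ⬝ᵥ v = 1 := by
      have h := hH.eigenvectorBasis.orthonormal.1 (e last)
      have h' : ‖hH.eigenvectorBasis (e last)‖ ^ 2 = 1 := by rw [h, one_pow]
      rw [EuclideanSpace.norm_sq_eq] at h'
      rw [← h']
      simp only [dotProduct, Real.norm_eq_abs, sq_abs, hv]
      exact Finset.sum_congr rfl fun i _ => (sq _).symm
    have hN0 : (N : ℝ) ≠ 0 := by positivity
    rw [hv'] at hnorm ⊢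
    simp only [dotProduct, Finset.sum_const, Finset.card_univ, Fintype.card_fin, nsmul_eq_mul,
      ← Finset.mul_sum] at hnorm ⊢
    field_simp
    linear_combination (∑ i, s i) ^ 2 * hnorm
  -- In decreasing order λ₂ has index N - 2 and λ_N index 0; every mode but the last lies between
  -- them.
  have hmode : ∀ m, m ≠ e last → consensusBound α ϱsq (hH.eigenvalues m) ≤ d := by
    intro m hm
    have hk : e.symm m ≠ last := fun h => hm (by rw [← h, e.apply_symm_apply])
    have hk' : (e.symm m : ℕ) ≠ N - 1 := fun h => hk (Fin.ext h)
    have hlt := (e.symm m).2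
    refine consensusBound_le_of_mem_Icc hϱ h2 h3 ?_ ?_
    · rw [← e.apply_symm_apply m, hev]
      refine hH.eigenvalues₀_antitone ?_
      rw [Fin.le_def]
      simp only [Fin.val_cast, Fin.val_rev]
      omega
    · rw [← e.apply_symm_apply m, hev]
      refine hH.eigenvalues₀_antitone ?_
      rw [Fin.le_def]
      simp only [Fin.val_cast, Fin.val_rev]
      omega
  rw [← hconst, dotProduct_eq_sum_eigenvectorBasis hH s s,
    dotProduct_eq_sum_eigenvectorBasis hH s (G.lapMatrix ℝ *ᵥ s),
    dotProduct_eq_sum_eigenvectorBasis hH (G.lapMatrix ℝ *ᵥ s) (G.lapMatrix ℝ *ᵥ s)]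
  simp only [eigenvectorBasis_dotProduct_mulVec]
  rw [← Finset.add_sum_erase _ (fun m => ((hH.eigenvectorBasis m).ofLp ⬝ᵥ s) *
    ((hH.eigenvectorBasis m).ofLp ⬝ᵥ s)) (Finset.mem_univ (e last)), ← sq, add_sub_cancel_left,
    Finset.mul_sum, Finset.mul_sum, Finset.mul_sum, ← Finset.sum_add_distrib,
    ← Finset.add_sum_erase _ _ (Finset.mem_univ (e last)), hzero]
  have h0 : ∀ c : ℝ, -2 * α * (c * (0 * c)) + α ^ 2 * (1 + ϱsq) * (0 * c * (0 * c)) = 0 := by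
    intro c; ring
  rw [h0, zero_add]
  refine Finset.sum_le_sum fun m hm => ?_
  have h4 := hmode m (Finset.ne_of_mem_erase hm)
  -- Modewise, -2αλ + α²(1 + ϱ²)λ² is the consensus bound minus 1.
  have h5 := mul_le_mul_of_nonneg_right h4 (sq_nonneg ((hH.eigenvectorBasis m).ofLp ⬝ᵥ s))
  unfold consensusBound at h5
  linarith

end Laplacian

/-! ### One-step decrease of the pairwise disagreement. -/

section Disagreement

variable {n N : ℕ}

lemma sum_sum_sub_mul_sub (f h : Fin N → ℝ) :
    ∑ i, ∑ j, (f i - f j) * (h i - h j) = 2 * N * (f ⬝ᵥ h) - 2 * ((∑ i, f i) * ∑ i, h i) := by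
  have e : ∀ i j, (f i - f j) * (h i - h j) = f i * h i + f j * h j - f i * h j - h i * f j := by
    intro i j; ring
  simp only [e, Finset.sum_sub_distrib, Finset.sum_add_distrib, Finset.sum_const,
    Finset.card_univ, Fintype.card_fin, nsmul_eq_mul, ← Finset.mul_sum, ← Finset.sum_mul,
    dotProduct]
  ring

lemma sum_lapMatrix_mulVec (G : SimpleGraph (Fin N)) [DecidableRel G.Adj] (κ : Fin N → ℝ) :
    ∑ i, (G.lapMatrix ℝ *ᵥ κ) i = 0 := by
  have h1 : ∑ i, (G.lapMatrix ℝ *ᵥ κ) i = (fun _ => 1) ⬝ᵥ G.lapMatrix ℝ *ᵥ κ := by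
    simp [dotProduct]
  rw [h1, dotProduct_mulVec, ← mulVec_transpose, (G.isSymm_lapMatrix ℝ).eq,
    G.lapMatrix_mulVec_const_eq_zero, zero_dotProduct]

/-- The expected one step decrease of the sum of the pairwise disagreements. -/
lemma sum_quadForm_step_le (hN : 1 < N) (hN1 : N - 1 < N) (G : SimpleGraph (Fin N))
    [DecidableRel G.Adj] (hG : G.Connected) {α ϱsq d : ℝ} (hϱ : 0 ≤ ϱsq)
    (h2 : consensusBound α ϱsq (lapEigenvalue G ⟨1, hN⟩) ≤ d)
    (h3 : consensusBound α ϱsq (lapEigenvalue G ⟨N - 1, hN1⟩) ≤ d)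
    {σ : Fin N → ℝ} (hσ : ∀ i, σ i ^ 2 ≤ ϱsq)
    {A P Q : Matrix (Fin n) (Fin n) ℝ} {b k : Fin n → ℝ} (hP : P.PosDef)
    (hk : ∀ y, quadForm P b * (k ⬝ᵥ y) = -(b ⬝ᵥ P *ᵥ A *ᵥ y))
    (hfix : ∀ y, quadForm P y = quadForm P (A *ᵥ y) - (1 - d) * (quadForm P b * (k ⬝ᵥ y) ^ 2) +
      quadForm Q y) (x : Fin N → Fin n → ℝ) (r : Fin N → ℝ)
    (hr : r = G.lapMatrix ℝ *ᵥ fun i => k ⬝ᵥ x i) :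
    ∑ i, ∑ j, (quadForm P (A *ᵥ (x i - x j) + (α * r i - α * r j) • b) +
        quadForm P b * (σ i ^ 2 * (α * r i) ^ 2 + σ j ^ 2 * (α * r j) ^ 2)) ≤
      ∑ i, ∑ j, (quadForm P (x i - x j) - quadForm Q (x i - x j)) := by
  set κ : Fin N → ℝ := fun i => k ⬝ᵥ x i with hκ
  have hg := hP.quadForm_nonneg b
  have hlap := lapMatrix_disagreement_le G hN hN1 hG hϱ h2 h3 κ
  rw [← hr] at hlap
  have hr0 : ∑ i, r i = 0 := by rw [hr]; exact sum_lapMatrix_mulVec G κ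
  -- The gain identity turns the cross term, and the Riccati equation the drift term, into multiples
  -- of bᵀPb.
  have hterm : ∀ i j, quadForm P (A *ᵥ (x i - x j) + (α * r i - α * r j) • b) +
        quadForm P b * (σ i ^ 2 * (α * r i) ^ 2 + σ j ^ 2 * (α * r j) ^ 2) =
      (quadForm P (x i - x j) - quadForm Q (x i - x j)) + quadForm P b *
        ((1 - d) * ((κ i - κ j) * (κ i - κ j)) - 2 * α * ((r i - r j) * (κ i - κ j)) +
          α ^ 2 * ((r i - r j) * (r i - r j)) +
          (α ^ 2 * (σ i ^ 2 * r i ^ 2) + α ^ 2 * (σ j ^ 2 * r j ^ 2))) := by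
    intro i j
    have e1 := hk (x i - x j)
    have e2 := hfix (x i - x j)
    rw [dotProduct_sub] at e1 e2
    rw [quadForm_add_right hP.isSymm, quadForm_smul_right, mulVec_smul, dotProduct_smul,
      smul_eq_mul, dotProduct_mulVec_symm hP.isSymm _ b]
    linear_combination (-1) * e2 + 2 * (α * r i - α * r j) * e1
  -- Since the r_i sum to zero, the pair sums of r reduce to 2N times dot products, and the
  -- variances add at most 2N α²ϱ² (r ⬝ᵥ r).
  have hsum : ∑ i, ∑ j, ((1 - d) * ((κ i - κ j) * (κ i - κ j)) -
        2 * α * ((r i - r j) * (κ i - κ j)) + α ^ 2 * ((r i - r j) * (r i - r j)) +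
          (α ^ 2 * (σ i ^ 2 * r i ^ 2) + α ^ 2 * (σ j ^ 2 * r j ^ 2))) ≤ 0 := by
    simp only [Finset.sum_add_distrib, Finset.sum_sub_distrib, ← Finset.mul_sum,
      sum_sum_sub_mul_sub, hr0, Finset.sum_const, Finset.card_univ, Fintype.card_fin, nsmul_eq_mul]
    have hσr : ∑ i, σ i ^ 2 * r i ^ 2 ≤ ϱsq * (r ⬝ᵥ r) := by
      rw [dotProduct, Finset.mul_sum]
      refine Finset.sum_le_sum fun i _ => ?_
      rw [← sq]
      exact mul_le_mul_of_nonneg_right (hσ i) (sq_nonneg _)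
    have hN0 : (0 : ℝ) < N := by positivity
    have h4 := mul_le_mul_of_nonneg_left hσr (show 0 ≤ 2 * N * α ^ 2 by positivity)
    have h5 := mul_le_mul_of_nonneg_left hlap (show 0 ≤ 2 * (N : ℝ) by positivity)
    have h6 : 2 * (N : ℝ) * (-(1 - d) * (κ ⬝ᵥ κ - (∑ i, κ i) ^ 2 / N)) =
        -(1 - d) * (2 * N * (κ ⬝ᵥ κ) - 2 * ((∑ i, κ i) * ∑ i, κ i)) := by field_simp
    rw [h6] at h5
    rw [dotProduct_comm κ r] at h5
    have h7 : ∑ i, σ i ^ 2 * (N * r i ^ 2) = N * ∑ i, σ i ^ 2 * r i ^ 2 := by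
      rw [Finset.mul_sum]
      exact Finset.sum_congr rfl fun i _ => by ring
    rw [h7]
    linarith
  simp only [hterm]
  have hsplit : ∀ f h : Fin N → Fin N → ℝ, ∑ i, ∑ j, (f i j + quadForm P b * h i j) =
      ∑ i, ∑ j, f i j + quadForm P b * ∑ i, ∑ j, h i j := by
    intro f h
    simp only [Finset.sum_add_distrib, Finset.mul_sum]
  rw [hsplit]
  linarith [mul_nonneg hg (neg_nonneg.2 hsum)]

end Disagreement

/-! ### Agent dynamics through the Laplacian. -/

section Dynamics

variable {n N : ℕ} {A : Matrix (Fin n) (Fin n) ℝ} {B : Matrix (Fin n) (Fin 1) ℝ}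
  {G : SimpleGraph (Fin N)} [DecidableRel G.Adj] {α : ℝ} {K : Matrix (Fin 1) (Fin n) ℝ}

/-- The Laplacian feedback signal `∑_j a_ij K (x_i - x_j)`. -/
def feedbackSignal (G : SimpleGraph (Fin N)) [DecidableRel G.Adj] (k : Fin n → ℝ)
    (x : Fin N → Fin n → ℝ) : Fin N → ℝ :=
  G.lapMatrix ℝ *ᵥ fun i => k ⬝ᵥ x i

lemma mulVec_controlInput (w : Fin N → ℝ) (x : Fin N → Fin n → ℝ) (i : Fin N) :
    B *ᵥ controlInput G α K w x i =
      (α * (1 + w i) * feedbackSignal G (K.row 0) x i) • B.col 0 := by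
  have h0 : ∀ y, (K *ᵥ y) 0 = K.row 0 ⬝ᵥ y := fun y => rfl
  have h1 : controlInput G α K w x i 0 = α * (1 + w i) * feedbackSignal G (K.row 0) x i := by
    simp only [controlInput, feedbackSignal, Pi.smul_apply, Finset.sum_apply, smul_eq_mul, h0,
      dotProduct_sub, SimpleGraph.lapMatrix_mulVec_apply, SimpleGraph.adjMatrix_apply, ite_mul,
      one_mul, zero_mul, mul_assoc]
    rw [← Finset.sum_filter, ← Finset.mul_sum, Finset.sum_sub_distrib, Finset.sum_const,
      SimpleGraph.neighborFinset_eq_filter, ← SimpleGraph.card_neighborFinset_eq_degree,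
      SimpleGraph.neighborFinset_eq_filter, nsmul_eq_mul]
  ext c
  simp [mulVec, dotProduct, h1, mul_comm]

lemma agentState_succ (w : Fin N → ℕ → ℝ) (x₀ : Fin N → Fin n → ℝ) (k : ℕ) (i : Fin N) :
    agentState A B G α K w x₀ (k + 1) i = A *ᵥ agentState A B G α K w x₀ k i +
      (α * (1 + w i k) * feedbackSignal G (K.row 0) (agentState A B G α K w x₀ k) i) •
        B.col 0 := by
  simp only [agentState, mulVec_controlInput]

/-- Causality: only noise before time k enters the state at time k. -/
lemma agentState_congr {w w' : Fin N → ℕ → ℝ} (x₀ : Fin N → Fin n → ℝ) {k : ℕ}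
    (h : ∀ l, ∀ m < k, w l m = w' l m) :
    agentState A B G α K w x₀ k = agentState A B G α K w' x₀ k := by
  induction k with
  | zero => rfl
  | succ k ih =>
    ext1 i
    rw [agentState_succ, agentState_succ, ih fun l m hm => h l m (by omega), h i k (by omega)]

lemma continuous_feedbackSignal (k : Fin n → ℝ) (i : Fin N) :
    Continuous fun x : Fin N → Fin n → ℝ => feedbackSignal G k x i := by
  unfold feedbackSignal
  simp only [mulVec, dotProduct]
  fun_prop

lemma measurable_agentState {S : Type*} [MeasurableSpace S] {w : S → Fin N → ℕ → ℝ}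
    {x₀ : S → Fin N → Fin n → ℝ} (hw : ∀ l m, Measurable fun s => w s l m) (hx : Measurable x₀)
    (k : ℕ) : Measurable fun s => agentState A B G α K (w s) (x₀ s) k := by
  induction k with
  | zero => exact hx
  | succ k ih =>
    refine measurable_pi_iff.2 fun i => ?_
    simp only [agentState_succ]
    have h1 : Measurable fun s => A *ᵥ agentState A B G α K (w s) (x₀ s) k i := by
      have : Continuous fun x : Fin N → Fin n → ℝ => A *ᵥ x i := by fun_prop
      exact this.measurable.comp ih
    have h2 := (continuous_feedbackSignal (G := G) (K.row 0) i).measurable.comp ih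
    exact h1.add (((((hw i k).const_add 1).const_mul α).mul h2).smul_const _)

end Dynamics

/-! ### Independence and second moments. -/

section Stochastic

variable {Ω : Type*} [MeasurableSpace Ω] {μ : Measure Ω}

lemma ProbabilityTheory.IndepFun.prodMk_left_of_right [IsProbabilityMeasure μ] {S T U : Type*}
    [MeasurableSpace S] [MeasurableSpace T] [MeasurableSpace U] {X : Ω → S} {Y : Ω → T}
    {Z : Ω → U} (hX : Measurable X) (hY : Measurable Y) (hZ : Measurable Z)
    (h1 : IndepFun X (fun ω => (Y ω, Z ω)) μ) (h2 : IndepFun Y Z μ) :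
    IndepFun (fun ω => (X ω, Y ω)) Z μ := by
  have h3 : IndepFun X Y μ := h1.comp measurable_id measurable_fst
  have e1 := (indepFun_iff_map_prod_eq_prod_map_map hX.aemeasurable
    (hY.prodMk hZ).aemeasurable).1 h1
  have e2 := (indepFun_iff_map_prod_eq_prod_map_map hY.aemeasurable hZ.aemeasurable).1 h2
  have e3 := (indepFun_iff_map_prod_eq_prod_map_map hX.aemeasurable hY.aemeasurable).1 h3
  rw [indepFun_iff_map_prod_eq_prod_map_map (hX.prodMk hY).aemeasurable hZ.aemeasurable, e3]
  have := Measure.isProbabilityMeasure_map (μ := μ) hX.aemeasurable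
  have := Measure.isProbabilityMeasure_map (μ := μ) hY.aemeasurable
  have := Measure.isProbabilityMeasure_map (μ := μ) hZ.aemeasurable
  rw [e2, ← Measure.prodAssoc_prod] at e1
  have e4 : μ.map (fun ω => ((X ω, Y ω), Z ω)) =
      (μ.map fun ω => (X ω, (Y ω, Z ω))).map MeasurableEquiv.prodAssoc.symm := by
    rw [Measure.map_map (MeasurableEquiv.measurable _) (by fun_prop)]
    rfl
  rw [e4, e1, MeasurableEquiv.map_symm_map]

variable {n N : ℕ} {A : Matrix (Fin n) (Fin n) ℝ} {B : Matrix (Fin n) (Fin 1) ℝ}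
  {G : SimpleGraph (Fin N)} [DecidableRel G.Adj] {α : ℝ} {K : Matrix (Fin 1) (Fin n) ℝ}
  {Δ : Fin N → ℕ → Ω → ℝ} {σ : Fin N → ℝ} {x₀ : Ω → Fin N → Fin n → ℝ}

/-- The state at time `k` is independent of the uncertainties at time `k`. -/
lemma indepFun_agentState [IsProbabilityMeasure μ] (hΔ : IsInputNoise μ Δ σ)
    (hx : Measurable x₀) (hind : IndepFun x₀ (fun ω (p : Fin N × ℕ) => Δ p.1 p.2 ω) μ) (k : ℕ) :
    IndepFun (fun ω => agentState A B G α K (fun l m => Δ l m ω) (x₀ ω) k)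
      (fun ω l => Δ l k ω) μ := by
  let S : Finset (Fin N × ℕ) := Finset.univ ×ˢ Finset.range k
  let T : Finset (Fin N × ℕ) := Finset.univ ×ˢ {k}
  have hST : Disjoint S T := by
    rw [Finset.disjoint_left]
    rintro ⟨l, m⟩ h1 h2
    simp only [S, T, Finset.mem_product, Finset.mem_range, Finset.mem_singleton] at h1 h2
    omega
  have hm : ∀ p : Fin N × ℕ, Measurable (Δ p.1 p.2) := fun p => hΔ.measurable _ _
  have h1 := hΔ.indep.indepFun_finset S T hST hm
  have h2 : IndepFun x₀ (fun ω => ((fun (p : S) => Δ p.1.1 p.1.2 ω),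
      (fun (p : T) => Δ p.1.1 p.1.2 ω))) μ := by
    have hφ : Measurable fun f : Fin N × ℕ → ℝ =>
        ((fun p : S => f p.1), (fun p : T => f p.1)) := by fun_prop
    exact hind.comp measurable_id hφ
  have h3 := h2.prodMk_left_of_right hx (by fun_prop) (by fun_prop) h1
  classical
  -- By causality, noise outside the past set `S` may be set to 0, making the state a function of x₀
  -- and the past alone.
  let trunc : (Fin N → Fin n → ℝ) × (S → ℝ) → Fin N → ℕ → ℝ := fun s l m =>
    if h : (l, m) ∈ S then s.2 ⟨(l, m), h⟩ else 0
  have hφ : Measurable fun s : (Fin N → Fin n → ℝ) × (S → ℝ) =>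
      agentState A B G α K (trunc s) s.1 k := by
    refine measurable_agentState (fun l m => ?_) measurable_fst k
    by_cases h : (l, m) ∈ S
    · simp only [trunc, h, dite_true]; fun_prop
    · simp only [trunc, h, dite_false]; fun_prop
  have hψ : Measurable fun (f : T → ℝ) (l : Fin N) => f ⟨(l, k), by simp [T]⟩ := by fun_prop
  have h4 := h3.comp hφ hψ
  have e : (fun ω => agentState A B G α K (fun l m => Δ l m ω) (x₀ ω) k) =
      (fun s : (Fin N → Fin n → ℝ) × (S → ℝ) => agentState A B G α K (trunc s) s.1 k) ∘
        fun ω => (x₀ ω, fun p : S => Δ p.1.1 p.1.2 ω) := by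
    ext1 ω
    refine agentState_congr _ fun l m hmk => ?_
    have h : (l, m) ∈ S := by simp [S, hmk]
    simp [trunc, h]
  rw [e]
  exact h4

lemma MeasureTheory.MemLp.feedbackSignal {Y : Ω → Fin N → Fin n → ℝ} (hY : MemLp Y 2 μ)
    (k : Fin n → ℝ) (i : Fin N) : MemLp (fun ω => feedbackSignal G k (Y ω) i) 2 μ := by
  simp only [_root_.feedbackSignal, mulVec, dotProduct]
  exact memLp_finsetSum _ fun j _ => (memLp_finsetSum _ fun c _ =>
    (memLp_pi_iff.1 (memLp_pi_iff.1 hY j) c).const_mul _).const_mul _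

lemma MeasureTheory.MemLp.mulVec {Y : Ω → Fin n → ℝ} (hY : MemLp Y 2 μ)
    (M : Matrix (Fin n) (Fin n) ℝ) : MemLp (fun ω => M *ᵥ Y ω) 2 μ := by
  refine memLp_pi_iff.2 fun i => ?_
  simp only [Matrix.mulVec, dotProduct]
  exact memLp_finsetSum _ fun j _ => (memLp_pi_iff.1 hY j).const_mul _

lemma MeasureTheory.MemLp.dotProduct_left {Y : Ω → Fin n → ℝ} (hY : MemLp Y 2 μ)
    (v : Fin n → ℝ) : MemLp (fun ω => v ⬝ᵥ Y ω) 2 μ := by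
  simp only [dotProduct]
  exact memLp_finsetSum _ fun j _ => (memLp_pi_iff.1 hY j).const_mul _

lemma MeasureTheory.MemLp.integrable_quadForm {Y : Ω → Fin n → ℝ} (hY : MemLp Y 2 μ)
    (P : Matrix (Fin n) (Fin n) ℝ) : Integrable (fun ω => quadForm P (Y ω)) μ := by
  simp only [quadForm]
  simp only [dotProduct]
  exact integrable_finsetSum _ fun j _ =>
    (memLp_pi_iff.1 hY j).integrable_mul (memLp_pi_iff.1 (hY.mulVec P) j)

/-- The squares are independent and integrable, so their product is integrable. This keeps the
states square integrable under multiplicative noise. -/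
lemma ProbabilityTheory.IndepFun.memLp_two_mul {X Y : Ω → ℝ} (h : IndepFun X Y μ)
    (hX : MemLp X 2 μ) (hY : MemLp Y 2 μ) : MemLp (fun ω => X ω * Y ω) 2 μ := by
  refine (memLp_two_iff_integrable_sq
    (hX.aestronglyMeasurable.mul hY.aestronglyMeasurable)).2 ?_
  have hsq : Measurable fun t : ℝ => t ^ 2 := by fun_prop
  have h1 : IndepFun (fun ω => X ω ^ 2) (fun ω => Y ω ^ 2) μ := h.comp hsq hsq
  have h2 := h1.integrable_mul hX.integrable_sq hY.integrable_sq
  refine h2.congr (Eventually.of_forall fun ω => ?_)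
  simp [mul_pow]

lemma memLp_agentState [IsProbabilityMeasure μ] (hΔ : IsInputNoise μ Δ σ)
    (hx : Measurable x₀) (hx2 : MemLp x₀ 2 μ)
    (hind : IndepFun x₀ (fun ω (p : Fin N × ℕ) => Δ p.1 p.2 ω) μ) (k : ℕ) :
    MemLp (fun ω => agentState A B G α K (fun l m => Δ l m ω) (x₀ ω) k) 2 μ := by
  induction k with
  | zero => exact hx2
  | succ k ih =>
    refine memLp_pi_iff.2 fun i => ?_
    simp only [agentState_succ]
    refine ((memLp_pi_iff.1 ih i).mulVec A).add (memLp_pi_iff.2 fun c => ?_)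
    have hr := ih.feedbackSignal (G := G) (K.row 0) i
    have h1 := (indepFun_agentState (A := A) (B := B) (G := G) (α := α) (K := K) hΔ hx hind k)
    have h2 : IndepFun (Δ i k) (fun ω => feedbackSignal G (K.row 0)
        (agentState A B G α K (fun l m => Δ l m ω) (x₀ ω) k) i) μ :=
      (h1.comp (continuous_feedbackSignal (G := G) (K.row 0) i).measurable
        (measurable_pi_apply i)).symm
    have h3 := h2.memLp_two_mul (hΔ.memLp i k) hr
    have h4 := ((hr.add h3).const_mul α).mul_const (B.col 0 c)
    refine h4.ae_eq (Eventually.of_forall fun ω => ?_)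
    simp only [Pi.add_apply, Pi.smul_apply, smul_eq_mul]
    ring

/-- The second moment of the difference of two agents after one step. -/
lemma integral_quadForm_step [IsProbabilityMeasure μ] {P : Matrix (Fin n) (Fin n) ℝ}
    (hP : P.PosDef) (b : Fin n → ℝ) {ξ η : Ω → ℝ} {D : Ω → Fin n → ℝ} {s t : ℝ}
    {p q : Ω → ℝ} (hD : MemLp D 2 μ) (hp : MemLp p 2 μ) (hq : MemLp q 2 μ)
    (hξ : MemLp ξ 2 μ) (hη : MemLp η 2 μ) (hξ0 : ∫ ω, ξ ω ∂μ = 0) (hη0 : ∫ ω, η ω ∂μ = 0)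
    (hξ2 : ∫ ω, ξ ω ^ 2 ∂μ = s ^ 2) (hη2 : ∫ ω, η ω ^ 2 ∂μ = t ^ 2) (hξη : IndepFun ξ η μ)
    (hind : IndepFun (fun ω => (D ω, p ω, q ω)) (fun ω => (ξ ω, η ω)) μ) :
    ∫ ω, quadForm P (D ω + (ξ ω * p ω - η ω * q ω) • b) ∂μ =
      ∫ ω, (quadForm P (D ω) + quadForm P b * (s ^ 2 * p ω ^ 2 + t ^ 2 * q ω ^ 2)) ∂μ := by
  -- Expectations of state factors times noise factors split; all terms linear in ξ or η, and the
  -- mixed term ξη, then vanish.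
  have key : ∀ (f : (Fin n → ℝ) × ℝ × ℝ → ℝ) (g : ℝ × ℝ → ℝ), Measurable f → Measurable g →
      Integrable (fun ω => f (D ω, p ω, q ω)) μ → Integrable (fun ω => g (ξ ω, η ω)) μ →
      Integrable (fun ω => f (D ω, p ω, q ω) * g (ξ ω, η ω)) μ ∧
      ∫ ω, f (D ω, p ω, q ω) * g (ξ ω, η ω) ∂μ =
        (∫ ω, f (D ω, p ω, q ω) ∂μ) * ∫ ω, g (ξ ω, η ω) ∂μ := by
    intro f g hf hg hfi hgi
    have h := hind.comp hf hg
    exact ⟨h.integrable_mul hfi hgi,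
      h.integral_fun_mul_eq_mul_integral hfi.aestronglyMeasurable hgi.aestronglyMeasurable⟩
  have hbPD : MemLp (fun ω => b ⬝ᵥ P *ᵥ D ω) 2 μ := (hD.mulVec P).dotProduct_left b
  have hmeas : Measurable fun z : (Fin n → ℝ) × ℝ × ℝ => b ⬝ᵥ P *ᵥ z.1 := by
    have : Continuous fun z : (Fin n → ℝ) × ℝ × ℝ => b ⬝ᵥ P *ᵥ z.1 := by fun_prop
    exact this.measurable
  have hξi := hξ.integrable one_le_two
  have hηi := hη.integrable one_le_two
  obtain ⟨i1, e1⟩ := key (fun z => z.2.1 * (b ⬝ᵥ P *ᵥ z.1)) (fun z => z.1) (by fun_prop)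
    (by fun_prop) (hp.integrable_mul hbPD) hξi
  obtain ⟨i2, e2⟩ := key (fun z => z.2.2 * (b ⬝ᵥ P *ᵥ z.1)) (fun z => z.2) (by fun_prop)
    (by fun_prop) (hq.integrable_mul hbPD) hηi
  obtain ⟨i3, e3⟩ := key (fun z => z.2.1 ^ 2) (fun z => z.1 ^ 2) (by fun_prop)
    (by fun_prop) hp.integrable_sq hξ.integrable_sq
  obtain ⟨i4, e4⟩ := key (fun z => z.2.2 ^ 2) (fun z => z.2 ^ 2) (by fun_prop)
    (by fun_prop) hq.integrable_sq hη.integrable_sq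
  obtain ⟨i5, e5⟩ := key (fun z => z.2.1 * z.2.2) (fun z => z.1 * z.2) (by fun_prop)
    (by fun_prop) (hp.integrable_mul hq) (hξη.integrable_mul hξi hηi)
  have e6 := hξη.integral_fun_mul_eq_mul_integral hξ.aestronglyMeasurable hη.aestronglyMeasurable
  simp only [hξ0, hη0, hξ2, hη2, e6, mul_zero] at e1 e2 e3 e4 e5
  have hexp : ∀ ω, quadForm P (D ω + (ξ ω * p ω - η ω * q ω) • b) =
      quadForm P (D ω) + (2 * (p ω * (b ⬝ᵥ P *ᵥ D ω) * ξ ω) +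
        (-2 * (q ω * (b ⬝ᵥ P *ᵥ D ω) * η ω) + (quadForm P b * (p ω ^ 2 * ξ ω ^ 2) +
          (quadForm P b * (q ω ^ 2 * η ω ^ 2) +
            -2 * quadForm P b * (p ω * q ω * (ξ ω * η ω)))))) := by
    intro ω
    rw [quadForm_add_right hP.isSymm, quadForm_smul_right, mulVec_smul, dotProduct_smul,
      smul_eq_mul, dotProduct_mulVec_symm hP.isSymm _ b]
    ring
  simp only [hexp]
  have iD := hD.integrable_quadForm P
  have j1 : Integrable (fun ω => 2 * (p ω * (b ⬝ᵥ P *ᵥ D ω) * ξ ω)) μ := i1.const_mul 2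
  have j2 : Integrable (fun ω => -2 * (q ω * (b ⬝ᵥ P *ᵥ D ω) * η ω)) μ := i2.const_mul (-2)
  have j3 : Integrable (fun ω => quadForm P b * (p ω ^ 2 * ξ ω ^ 2)) μ := i3.const_mul _
  have j4 : Integrable (fun ω => quadForm P b * (q ω ^ 2 * η ω ^ 2)) μ := i4.const_mul _
  have j5 : Integrable (fun ω => -2 * quadForm P b * (p ω * q ω * (ξ ω * η ω))) μ :=
    i5.const_mul _
  have j45 : Integrable (fun ω => quadForm P b * (q ω ^ 2 * η ω ^ 2) +
    -2 * quadForm P b * (p ω * q ω * (ξ ω * η ω))) μ := j4.add j5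
  have j35 : Integrable (fun ω => quadForm P b * (p ω ^ 2 * ξ ω ^ 2) +
    (quadForm P b * (q ω ^ 2 * η ω ^ 2) +
      -2 * quadForm P b * (p ω * q ω * (ξ ω * η ω)))) μ := j3.add j45
  have j25 : Integrable (fun ω => -2 * (q ω * (b ⬝ᵥ P *ᵥ D ω) * η ω) +
    (quadForm P b * (p ω ^ 2 * ξ ω ^ 2) + (quadForm P b * (q ω ^ 2 * η ω ^ 2) +
      -2 * quadForm P b * (p ω * q ω * (ξ ω * η ω))))) μ := j2.add j35
  have j15 : Integrable (fun ω => 2 * (p ω * (b ⬝ᵥ P *ᵥ D ω) * ξ ω) +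
    (-2 * (q ω * (b ⬝ᵥ P *ᵥ D ω) * η ω) + (quadForm P b * (p ω ^ 2 * ξ ω ^ 2) +
      (quadForm P b * (q ω ^ 2 * η ω ^ 2) +
        -2 * quadForm P b * (p ω * q ω * (ξ ω * η ω)))))) μ := j1.add j25
  have l3 := (hp.integrable_sq.const_mul (s ^ 2))
  have l4 := (hq.integrable_sq.const_mul (t ^ 2))
  have l34 : Integrable (fun ω => s ^ 2 * p ω ^ 2 + t ^ 2 * q ω ^ 2) μ := l3.add l4
  rw [integral_add iD j15, integral_add j1 j25, integral_add j2 j35, integral_add j3 j45,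
    integral_add j4 j5, integral_const_mul, integral_const_mul, integral_const_mul,
    integral_const_mul, integral_const_mul, e1, e2, e3, e4, e5,
    integral_add iD (l34.const_mul _), integral_const_mul, integral_add l3 l4,
    integral_const_mul, integral_const_mul]
  ring

end Stochastic

/-! ### Geometric decay and the main theorem. -/

section Consensus

variable {n N : ℕ} {A : Matrix (Fin n) (Fin n) ℝ} {B : Matrix (Fin n) (Fin 1) ℝ}
  {G : SimpleGraph (Fin N)} [DecidableRel G.Adj] {α : ℝ} {K : Matrix (Fin 1) (Fin n) ℝ}
  {Ω : Type*} [MeasurableSpace Ω] {μ : Measure Ω} [IsProbabilityMeasure μ]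
  {Δ : Fin N → ℕ → Ω → ℝ} {σ : Fin N → ℝ} {x₀ : Ω → Fin N → Fin n → ℝ}

lemma integral_quadForm_agentState_succ_le (hΔ : IsInputNoise μ Δ σ)
    (hx : Measurable x₀) (hx2 : MemLp x₀ 2 μ)
    (hind : IndepFun x₀ (fun ω (p : Fin N × ℕ) => Δ p.1 p.2 ω) μ)
    {P : Matrix (Fin n) (Fin n) ℝ} (hP : P.PosDef) (k : ℕ) (i j : Fin N) {X : Ω → Fin N → Fin n → ℝ}
    (hX : X = fun ω => agentState A B G α K (fun l m => Δ l m ω) (x₀ ω) k) :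
    ∫ ω, quadForm P (agentState A B G α K (fun l m => Δ l m ω) (x₀ ω) (k + 1) i -
        agentState A B G α K (fun l m => Δ l m ω) (x₀ ω) (k + 1) j) ∂μ ≤
      ∫ ω, (quadForm P (A *ᵥ (X ω i - X ω j) + (α * feedbackSignal G (K.row 0) (X ω) i -
          α * feedbackSignal G (K.row 0) (X ω) j) • B.col 0) +
        quadForm P (B.col 0) * (σ i ^ 2 * (α * feedbackSignal G (K.row 0) (X ω) i) ^ 2 +
          σ j ^ 2 * (α * feedbackSignal G (K.row 0) (X ω) j) ^ 2)) ∂μ := by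
  -- On the diagonal the common noise cancels and the left side is 0, while the right side is only
  -- nonnegative. Off the diagonal equality holds.
  rcases eq_or_ne i j with rfl | hij
  · simp only [sub_self, quadForm_zero_right, integral_zero]
    refine integral_nonneg fun ω => add_nonneg (hP.quadForm_nonneg _) ?_
    exact mul_nonneg (hP.quadForm_nonneg _) (by positivity)
  have hXL : MemLp X 2 μ := by rw [hX]; exact memLp_agentState hΔ hx hx2 hind k
  have hXi : IndepFun X (fun ω l => Δ l k ω) μ := by
    rw [hX]; exact indepFun_agentState hΔ hx hind k
  have hr : ∀ l, MemLp (fun ω => α * feedbackSignal G (K.row 0) (X ω) l) 2 μ := fun l =>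
    (hXL.feedbackSignal (K.row 0) l).const_mul α
  have hcr : ∀ l, Continuous fun x : Fin N → Fin n → ℝ => α * feedbackSignal G (K.row 0) x l :=
    fun l => (continuous_feedbackSignal (K.row 0) l).const_mul α
  have hcD : Continuous fun x : Fin N → Fin n → ℝ => A *ᵥ (x i - x j) +
      (α * feedbackSignal G (K.row 0) x i - α * feedbackSignal G (K.row 0) x j) • B.col 0 := by
    refine Continuous.add (by fun_prop) (((hcr i).sub (hcr j)).smul continuous_const)
  have hD : MemLp (fun ω => A *ᵥ (X ω i - X ω j) + (α * feedbackSignal G (K.row 0) (X ω) i -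
      α * feedbackSignal G (K.row 0) (X ω) j) • B.col 0) 2 μ := by
    refine MemLp.add (((memLp_pi_iff.1 hXL i).sub (memLp_pi_iff.1 hXL j)).mulVec A)
      (memLp_pi_iff.2 fun c => ?_)
    exact ((hr i).sub (hr j)).mul_const (B.col 0 c)
  have h := integral_quadForm_step hP (B.col 0) hD (hr i) (hr j) (hΔ.memLp i k) (hΔ.memLp j k)
    (hΔ.mean i k) (hΔ.mean j k) (hΔ.variance i k) (hΔ.variance j k)
    (hΔ.indep.indepFun (i := (i, k)) (j := (j, k)) (by simpa using hij))
    (hXi.comp (hcD.measurable.prodMk ((hcr i).measurable.prodMk (hcr j).measurable))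
      ((measurable_pi_apply i).prodMk (measurable_pi_apply j)))
  refine le_of_eq ?_
  rw [← h]
  refine integral_congr_ae (Eventually.of_forall fun ω => ?_)
  simp only [agentState_succ, hX]
  congr 1
  rw [mulVec_sub]
  module

theorem solvesMeanSquareConsensus_of_riccati (hN : 1 < N) (hN1 : N - 1 < N) (hG : G.Connected)
    (hΔ : IsInputNoise μ Δ σ) {ϱsq d : ℝ} (hϱ : 0 ≤ ϱsq) (hσ : ∀ i, σ i ^ 2 ≤ ϱsq)
    (h2 : consensusBound α ϱsq (lapEigenvalue G ⟨1, hN⟩) ≤ d)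
    (h3 : consensusBound α ϱsq (lapEigenvalue G ⟨N - 1, hN1⟩) ≤ d)
    {P Q : Matrix (Fin n) (Fin n) ℝ} (hP : P.PosDef) (hQ : Q.PosDef)
    (hk : ∀ y, quadForm P (B.col 0) * (K.row 0 ⬝ᵥ y) = -(B.col 0 ⬝ᵥ P *ᵥ A *ᵥ y))
    (hfix : ∀ y, quadForm P y = quadForm P (A *ᵥ y) -
      (1 - d) * (quadForm P (B.col 0) * (K.row 0 ⬝ᵥ y) ^ 2) + quadForm Q y) :
    SolvesMeanSquareConsensus A B G α K μ Δ := by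
  intro x₀ hx hx2 hind i j
  let X : ℕ → Ω → Fin N → Fin n → ℝ := fun k ω =>
    agentState A B G α K (fun l m => Δ l m ω) (x₀ ω) k
  have hXL : ∀ k, MemLp (X k) 2 μ := fun k => memLp_agentState hΔ hx hx2 hind k
  have hdiff : ∀ k i j, MemLp (fun ω => X k ω i - X k ω j) 2 μ := fun k i j =>
    (memLp_pi_iff.1 (hXL k) i).sub (memLp_pi_iff.1 (hXL k) j)
  have hint : ∀ (M : Matrix (Fin n) (Fin n) ℝ) k i j,
      Integrable (fun ω => quadForm M (X k ω i - X k ω j)) μ := fun M k i j =>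
    (hdiff k i j).integrable_quadForm M
  let V : ℕ → ℝ := fun k => ∫ ω, ∑ i, ∑ j, quadForm P (X k ω i - X k ω j) ∂μ
  have hintV : ∀ k, Integrable (fun ω => ∑ i, ∑ j, quadForm P (X k ω i - X k ω j)) μ := fun k =>
    integrable_finsetSum _ fun i _ => integrable_finsetSum _ fun j _ => hint P k i j
  have hV0 : ∀ k, 0 ≤ V k := fun k => integral_nonneg fun ω =>
    Finset.sum_nonneg fun i _ => Finset.sum_nonneg fun j _ => hP.quadForm_nonneg _
  obtain ⟨C, hC, hCQ⟩ := hQ.exists_quadForm_le P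
  -- D ≥ 1 places the decay factor 1 - D⁻¹ in [0, 1).
  let D := max C 1
  have hD1 : 1 ≤ D := le_max_right _ _
  have hDQ : ∀ x, D⁻¹ * quadForm P x ≤ quadForm Q x := fun x => by
    rw [inv_mul_le_iff₀ (by positivity)]
    exact (hCQ x).trans (mul_le_mul_of_nonneg_right (le_max_left _ _) (hQ.quadForm_nonneg x))
  have hη0 : 0 < D⁻¹ := by positivity
  have hη1 : D⁻¹ ≤ 1 := inv_le_one_of_one_le₀ hD1
  have hstep : ∀ k, V (k + 1) ≤ (1 - D⁻¹) * V k := by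
    intro k
    have hr : ∀ l, MemLp (fun ω => α * feedbackSignal G (K.row 0) (X k ω) l) 2 μ := fun l =>
      ((hXL k).feedbackSignal (K.row 0) l).const_mul α
    have hDL : ∀ i j, MemLp (fun ω => A *ᵥ (X k ω i - X k ω j) +
        (α * feedbackSignal G (K.row 0) (X k ω) i - α * feedbackSignal G (K.row 0) (X k ω) j) •
          B.col 0) 2 μ := fun i j =>
      MemLp.add ((hdiff k i j).mulVec A) (memLp_pi_iff.2 fun c =>
        ((hr i).sub (hr j)).mul_const (B.col 0 c))
    have hint2 : ∀ i j, Integrable (fun ω => quadForm P (A *ᵥ (X k ω i - X k ω j) +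
        (α * feedbackSignal G (K.row 0) (X k ω) i - α * feedbackSignal G (K.row 0) (X k ω) j) •
          B.col 0) + quadForm P (B.col 0) *
            (σ i ^ 2 * (α * feedbackSignal G (K.row 0) (X k ω) i) ^ 2 +
              σ j ^ 2 * (α * feedbackSignal G (K.row 0) (X k ω) j) ^ 2)) μ := fun i j =>
      ((hDL i j).integrable_quadForm P).add
        ((((hr i).integrable_sq.const_mul _).add ((hr j).integrable_sq.const_mul _)).const_mul _)
    calc V (k + 1) = ∑ i, ∑ j, ∫ ω, quadForm P (X (k + 1) ω i - X (k + 1) ω j) ∂μ := by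
          simp only [V]
          rw [integral_finsetSum _ fun i _ => integrable_finsetSum _ fun j _ => hint P (k + 1) i j]
          exact Finset.sum_congr rfl fun i _ => integral_finsetSum _ fun j _ => hint P (k + 1) i j
      _ ≤ ∑ i, ∑ j, ∫ ω, (quadForm P (A *ᵥ (X k ω i - X k ω j) +
            (α * feedbackSignal G (K.row 0) (X k ω) i -
              α * feedbackSignal G (K.row 0) (X k ω) j) • B.col 0) + quadForm P (B.col 0) *
                (σ i ^ 2 * (α * feedbackSignal G (K.row 0) (X k ω) i) ^ 2 +
                  σ j ^ 2 * (α * feedbackSignal G (K.row 0) (X k ω) j) ^ 2)) ∂μ :=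
          Finset.sum_le_sum fun i _ => Finset.sum_le_sum fun j _ =>
            integral_quadForm_agentState_succ_le hΔ hx hx2 hind hP k i j rfl
      _ = ∫ ω, ∑ i, ∑ j, (quadForm P (A *ᵥ (X k ω i - X k ω j) +
            (α * feedbackSignal G (K.row 0) (X k ω) i -
              α * feedbackSignal G (K.row 0) (X k ω) j) • B.col 0) + quadForm P (B.col 0) *
                (σ i ^ 2 * (α * feedbackSignal G (K.row 0) (X k ω) i) ^ 2 +
                  σ j ^ 2 * (α * feedbackSignal G (K.row 0) (X k ω) j) ^ 2)) ∂μ := by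
          rw [integral_finsetSum _ fun i _ => integrable_finsetSum _ fun j _ => hint2 i j]
          exact Finset.sum_congr rfl fun i _ =>
            (integral_finsetSum _ fun j _ => hint2 i j).symm
      _ ≤ ∫ ω, (1 - D⁻¹) * ∑ i, ∑ j, quadForm P (X k ω i - X k ω j) ∂μ := by
          refine integral_mono (integrable_finsetSum _ fun i _ => integrable_finsetSum _ fun j _ =>
            hint2 i j) ((hintV k).const_mul _) fun ω => ?_
          refine (sum_quadForm_step_le hN hN1 G hG hϱ h2 h3 hσ hP hk hfix (X k ω) _ rfl).trans ?_
          rw [Finset.mul_sum]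
          refine Finset.sum_le_sum fun i _ => ?_
          rw [Finset.mul_sum]
          refine Finset.sum_le_sum fun j _ => ?_
          linarith [hDQ (X k ω i - X k ω j)]
      _ = (1 - D⁻¹) * V k := integral_const_mul _ _
  have hgeo : ∀ k, V k ≤ (1 - D⁻¹) ^ k * V 0 := by
    intro k
    induction k with
    | zero => simp
    | succ k ih =>
      rw [pow_succ', mul_assoc]
      exact (hstep k).trans (mul_le_mul_of_nonneg_left ih (by linarith))
  have hVlim : Tendsto (fun k => (1 - D⁻¹) ^ k * V 0) atTop (𝓝 0) := by
    simpa using (tendsto_pow_atTop_nhds_zero_of_lt_one (r := 1 - D⁻¹) (by linarith)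
      (by linarith)).mul_const (V 0)
  obtain ⟨c, hc, hcP⟩ := hP.exists_quadForm_le (1 : Matrix (Fin n) (Fin n) ℝ)
  have hnorm : ∀ y : Fin n → ℝ, ‖WithLp.toLp 2 y‖ ^ 2 = quadForm 1 y := by
    intro y
    rw [EuclideanSpace.norm_sq_eq]
    simp [quadForm, dotProduct, sq]
  simp only [hnorm]
  refine ⟨fun k => hint 1 k i j, ?_⟩
  refine squeeze_zero (fun k => integral_nonneg fun ω => Matrix.PosDef.one.quadForm_nonneg _)
    (g := fun k => c * ((1 - D⁻¹) ^ k * V 0)) (fun k => ?_) (by simpa using hVlim.const_mul c)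
  calc ∫ ω, quadForm 1 (X k ω i - X k ω j) ∂μ
      ≤ ∫ ω, c * ∑ i, ∑ j, quadForm P (X k ω i - X k ω j) ∂μ := by
        refine integral_mono (hint 1 k i j) ((hintV k).const_mul c) fun ω => ?_
        refine (hcP _).trans (mul_le_mul_of_nonneg_left ?_ hc.le)
        refine (Finset.single_le_sum (f := fun j => quadForm P (X k ω i - X k ω j))
          (fun j _ => hP.quadForm_nonneg _) (Finset.mem_univ j)).trans ?_
        exact Finset.single_le_sum (f := fun i => ∑ j, quadForm P (X k ω i - X k ω j))
          (fun i _ => Finset.sum_nonneg fun j _ => hP.quadForm_nonneg _) (Finset.mem_univ i)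
    _ = c * V k := integral_const_mul _ _
    _ ≤ c * ((1 - D⁻¹) ^ k * V 0) := mul_le_mul_of_nonneg_left (hgeo k) hc.le

lemma riccatiGain_row_dotProduct (P : Matrix (Fin n) (Fin n) ℝ) (y : Fin n → ℝ) :
    (riccatiGain A B P).row 0 ⬝ᵥ y =
      -((quadForm P (B.col 0))⁻¹ * (B.col 0 ⬝ᵥ P *ᵥ A *ᵥ y)) := by
  have h1 : (riccatiGain A B P).row 0 ⬝ᵥ y = (riccatiGain A B P *ᵥ y) 0 := rfl
  rw [h1, riccatiGain, inv_transpose_mul_mul_col, ← smul_one_eq_diagonal,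
    Matrix.smul_mul, Matrix.smul_mul, Matrix.smul_mul, Matrix.one_mul,
    neg_mulVec, smul_mulVec, ← mulVec_mulVec, ← mulVec_mulVec]
  rfl

theorem solvesMeanSquareConsensus_riccatiGain (hN : 1 < N) (hN1 : N - 1 < N) (hG : G.Connected)
    (hΔ : IsInputNoise μ Δ σ) {ϱsq δ : ℝ} (hϱ : 0 ≤ ϱsq) (hσ : ∀ i, σ i ^ 2 ≤ ϱsq)
    (h2 : consensusBound α ϱsq (lapEigenvalue G ⟨1, hN⟩) ≤ δ ^ 2)
    (h3 : consensusBound α ϱsq (lapEigenvalue G ⟨N - 1, hN1⟩) ≤ δ ^ 2)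
    {P Q : Matrix (Fin n) (Fin n) ℝ} (hQ : Q.PosDef) (hPQ : IsMARESolution A B δ Q P) :
    SolvesMeanSquareConsensus A B G α (riccatiGain A B P) μ Δ := by
  obtain ⟨hP, hfix⟩ := hPQ
  rw [← riccatiMap_col_eq B δ Q hP.isSymm] at hfix
  -- If bᵀPb = 0 the inverse in the gain is 0, and the numerators vanish as well, so the gain
  -- identities persist.
  have hcases : quadForm P (B.col 0) = 0 → ∀ y, B.col 0 ⬝ᵥ P *ᵥ y = 0 := fun h y =>
    dotProduct_eq_zero_of_quadForm_eq_zero hP.isSymm hP.quadForm_nonneg h y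
  refine solvesMeanSquareConsensus_of_riccati hN hN1 hG hΔ hϱ hσ h2 h3 hP hQ
    (fun y => ?_) fun y => ?_
  · rw [riccatiGain_row_dotProduct]
    by_cases h : quadForm P (B.col 0) = 0
    · rw [h, hcases h]; simp
    · field_simp
  · have h := quadForm_riccatiMap (A := A) (b := B.col 0) (ρ := 0) (γ := 1 - δ ^ 2) hP.isSymm Q y
    rw [← hfix] at h
    rw [h, riccatiGain_row_dotProduct, zero_add]
    by_cases hb : quadForm P (B.col 0) = 0
    · simp [hb]
    · field_simp

end Consensus

theorem theorem3 {n N : ℕ} (hN : 2 ≤ N)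
    (A : Matrix (Fin n) (Fin n) ℝ) (B : Matrix (Fin n) (Fin 1) ℝ) (hAB : Stabilizable A B)
    (G : SimpleGraph (Fin N)) [DecidableRel G.Adj] (hG : G.Connected)
    {Ω : Type*} [MeasurableSpace Ω] (μ : Measure Ω) [IsProbabilityMeasure μ]
    (Δ : Fin N → ℕ → Ω → ℝ) (σ : Fin N → ℝ) (hΔ : IsInputNoise μ Δ σ)
    (α : ℝ) (hα : 0 < α)
    (ϱsq : ℝ) (hϱ : ϱsq = ⨆ i, σ i ^ 2)
    (lam2 lamN : ℝ) (h2 : lam2 = lapEigenvalue G ⟨1, by omega⟩)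
    (hlamN : lamN = lapEigenvalue G ⟨N - 1, by omega⟩)
    (hcond2 : consensusBound α ϱsq lam2 < 1 / matrixMahler A ^ 2)
    (hcondN : consensusBound α ϱsq lamN < 1 / matrixMahler A ^ 2) :
    (∃ K : Matrix (Fin 1) (Fin n) ℝ, SolvesMeanSquareConsensus A B G α K μ Δ) ∧
    ∀ (δ : ℝ) (Q : Matrix (Fin n) (Fin n) ℝ), Q.PosDef →
      max (consensusBound α ϱsq lam2) (consensusBound α ϱsq lamN) ≤ δ ^ 2 →
      δ ^ 2 < 1 / matrixMahler A ^ 2 →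
      (∃! P : Matrix (Fin n) (Fin n) ℝ, IsMARESolution A B δ Q P) ∧
      ∀ P : Matrix (Fin n) (Fin n) ℝ, IsMARESolution A B δ Q P →
        SolvesMeanSquareConsensus A B G α (riccatiGain A B P) μ Δ := by
  have hσ : ∀ i, σ i ^ 2 ≤ ϱsq := fun i => by
    rw [hϱ]; exact le_ciSup (f := fun i => σ i ^ 2) (Set.finite_range _).bddAbove i
  have hϱ0 : 0 ≤ ϱsq := (sq_nonneg _).trans (hσ ⟨0, by omega⟩)
  have main : ∀ (δ : ℝ) (Q : Matrix (Fin n) (Fin n) ℝ), Q.PosDef →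
      max (consensusBound α ϱsq lam2) (consensusBound α ϱsq lamN) ≤ δ ^ 2 →
      δ ^ 2 < 1 / matrixMahler A ^ 2 →
      (∃! P : Matrix (Fin n) (Fin n) ℝ, IsMARESolution A B δ Q P) ∧
      ∀ P : Matrix (Fin n) (Fin n) ℝ, IsMARESolution A B δ Q P →
        SolvesMeanSquareConsensus A B G α (riccatiGain A B P) μ Δ := by
    intro δ Q hQ hmax hδ
    refine ⟨existsUnique_isMARESolution hAB hδ hQ, fun P hP => ?_⟩
    subst h2 hlamN
    exact solvesMeanSquareConsensus_riccatiGain hN (by omega) hG hΔ hϱ0 hσ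
      ((le_max_left _ _).trans hmax)
      ((le_max_right _ _).trans hmax) hQ hP
  refine ⟨?_, main⟩
  have hnn : 0 ≤ max (consensusBound α ϱsq lam2) (consensusBound α ϱsq lamN) := by
    refine le_max_of_le_left ?_
    unfold consensusBound
    positivity
  have hsq := Real.sq_sqrt hnn
  -- Existence of a gain: Q = 1 and δ the square root of the larger consensus bound.
  obtain ⟨⟨P, hP, -⟩, hcons⟩ := main _ 1 Matrix.PosDef.one hsq.ge
    (by rw [hsq]; exact max_lt hcond2 hcondN)
  exact ⟨_, hcons P hP⟩
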